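/- Let $\mathcal A$ be a finite alphabet. A random substitution on $\mathcal A$ is a map $\vartheta$ assigning to each letter $a$ a non-empty finite set $\vartheta(a)$ of non-empty words over $\mathcal A$. It is extended to words by $\vartheta(u_0\cdots u_n)=\vartheta(u_0)\cdots\vartheta(u_n)$ (concatenation of sets of words) and to sets of words by taking unions, so that its powers $\vartheta^p$ are defined. For $y\in\mathcal A^{\mathbb Z}$, $\vartheta(y)$ is the set of all bi-infinite concatenations $\cdots w_{-1}.w_0w_1\cdots$ with $w_i\in\vartheta(y_i)$ for all $i$, where $w_0$ starts at position $0$. A word is legal if it is a subword of some word in $\vartheta^p(a)$ for some $a\in\mathcal A$ and $p\ge 0$, and $X_\vartheta\subseteq\mathcal A^{\mathbb Z}$ is the subshift of all bi-infinite sequences all of whose finite non-empty subwords are legal. Let $\sigma(x)_i=x_{i+1}$ denote the shift map. For a two-sided subshift $X$, $\operatorname{Aut}(X)$ is the group, under composition, of all homeomorphisms $X\to X$ commuting with $\sigma$. Assume that $\vartheta$ is - non-degenerate: $\#\vartheta(a)\neq 1$ for some $a\in\mathcal A$; - compatible: for every $a\in\mathcal A$, any two words in $\vartheta(a)$ contain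 each letter the same number of times (in particular, all words in $\vartheta(a)$ have a common length $|\vartheta(a)|$); - primitive: there is $p\ge1$ such that for all $a,b\in\mathcal A$ the letter $a$ occurs in some word of $\vartheta^p(b)$; - recognisable: for every $x\in X_\vartheta$ there is exactly one pair $(y,k)$ with $y\in X_\vartheta$, $0\le k\le|\vartheta(y_0)|-1$ and $\sigma^{-k}(x)\in\vartheta(y)$. Let $X_2=\{0,1\}^{\mathbb Z}$ be the full shift on two letters. Then there is an injective group homomorphism $\operatorname{Aut}(X_2)\to\operatorname{Aut}(X_\vartheta)$. -/

import Mathlib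

open SymbolicDynamics.FullShift

/-! ### Automorphism groups of two-sided subshifts -/

/-- The shift map `σ(x)_i = x_{i+1}`, as a homeomorphism of a two-sided subshift `X`. -/
def subshiftHomeo {A : Type*} [TopologicalSpace A] (X : Subshift A ℤ) :
    X.carrier ≃ₜ X.carrier where
  toFun x := ⟨shift 1 x.1, X.mapsTo 1 x.2⟩
  invFun x := ⟨shift (-1) x.1, X.mapsTo (-1) x.2⟩
  left_inv x := by ext i; simp [shift]
  right_inv x := by ext i; simp [shift]
  continuous_toFun := ((continuous_shift 1).comp continuous_subtype_val).subtype_mk _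
  continuous_invFun := ((continuous_shift (-1)).comp continuous_subtype_val).subtype_mk _

/-- `Aut(X)`: the group (under composition) of all homeomorphisms of `X` that commute with the
shift map. -/
def subshiftAut {A : Type*} [TopologicalSpace A] (X : Subshift A ℤ) :
    Subgroup (X.carrier ≃ₜ X.carrier) :=
  Subgroup.centralizer {subshiftHomeo X}

/-! ### Random substitutions -/

/-- A random substitution assigns to every letter a non-empty finite set of non-empty words. -/
structure RandomSubstitution (A : Type*) where
  /-- The set of words assigned to a letter. -/
  words : A → Finset (List A)
  nonempty : ∀ a, (words a).Nonempty
  nil_notMem : ∀ a, [] ∉ words a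

namespace RandomSubstitution

variable {A : Type*} (θ : RandomSubstitution A)

/-- The set `ϑ(u)` of realisations of `ϑ` on a finite word `u = u₀ ⋯ uₙ`, that is, the
concatenation `ϑ(u₀) ⋯ ϑ(uₙ)` of sets of words. -/
def onWord : List A → Set (List A)
  | [] => {[]}
  | a :: u => Set.image2 (fun v w => v ++ w) (θ.words a : Set (List A)) (onWord u)

/-- The extension of `ϑ` to sets of words. -/
def onSet (U : Set (List A)) : Set (List A) := ⋃ u ∈ U, θ.onWord u

/-- The iterated powers `ϑ^p` on sets of words. -/
def iter : ℕ → Set (List A) → Set (List A)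
  | 0, U => U
  | p + 1, U => θ.onSet (iter p U)

/-- The set `ϑ^p(a)` of level-`p` inflation words of type `a`. -/
def level (p : ℕ) (a : A) : Set (List A) := θ.iter p {[a]}

/-- A word is legal if it is a subword of some level-`p` inflation word, `p ≥ 0`. -/
def Legal (u : List A) : Prop := ∃ (a : A) (p : ℕ), ∃ v ∈ θ.level p a, u <:+: v

/-- The subword `x_{[i, i+n]}` (of length `n + 1`) of a bi-infinite sequence. -/
def window (x : ℤ → A) (i : ℤ) (n : ℕ) : List A :=
  List.ofFn fun k : Fin (n + 1) => x (i + k)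

/-- The RS-subshift `X_ϑ` as a set: all bi-infinite sequences whose (non-empty) subwords are all
legal. -/
def seqSet : Set (ℤ → A) := {x | ∀ (i : ℤ) (n : ℕ), θ.Legal (window x i n)}

/-- The RS-subshift `X_ϑ`, a closed shift-invariant subset of the full shift. -/
def subshift [TopologicalSpace A] [DiscreteTopology A] : Subshift A ℤ where
  carrier := θ.seqSet
  isClosed := by
    have h : θ.seqSet = ⋂ (i : ℤ) (n : ℕ),
        (fun (x : ℤ → A) (k : Fin (n + 1)) => x (i + k)) ⁻¹' {w | θ.Legal (List.ofFn w)} := by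
      ext x; simp [seqSet, window]
    rw [h]
    refine isClosed_iInter fun i => isClosed_iInter fun n => ?_
    exact (isClosed_discrete _).preimage (by fun_prop)
  mapsTo g x hx i n := by
    have h := hx (g + i) n
    simpa [window, shift, add_assoc] using h

/-- The set `ϑ(y)` of realisations of `ϑ` on a bi-infinite sequence `y`: the bi-infinite
concatenations `⋯ w₋₁ . w₀ w₁ ⋯` with `wᵢ ∈ ϑ(yᵢ)`, where `w₀` starts at the origin. Here `c i` is
the position at which `wᵢ` starts. -/
def onSeq (y : ℤ → A) : Set (ℤ → A) :=
  {x | ∃ (w : ℤ → List A) (c : ℤ → ℤ), (∀ i, w i ∈ θ.words (y i)) ∧ c 0 = 0 ∧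
    (∀ i, c (i + 1) = c i + (w i).length) ∧
    ∀ (i : ℤ) (j : ℕ) (hj : j < (w i).length), x (c i + j) = (w i)[j]}

/-- The abelianisation of a word: the vector of letter multiplicities. -/
def abelianisation [DecidableEq A] (u : List A) : A → ℕ := fun a => u.count a

/-- Any two realisations of the same letter have the same abelianisation. -/
def Compatible [DecidableEq A] : Prop :=
  ∀ a, ∀ u ∈ θ.words a, ∀ v ∈ θ.words a, abelianisation u = abelianisation v

/-- For some `p ≥ 1`, every letter `a` occurs in some word of `ϑ^p(b)`, for every letter `b`. -/
def Primitive : Prop :=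
  ∃ p : ℕ, 1 ≤ p ∧ ∀ a b : A, ∃ v ∈ θ.level p b, [a] <:+: v

/-- Every letter has exactly one realisation. -/
def Degenerate : Prop := ∀ a, (θ.words a).card = 1

/-- For every `x ∈ X_ϑ` there are a unique `y ∈ X_ϑ` and a unique `0 ≤ k ≤ |ϑ(y₀)| - 1` with
`σ^{-k}(x) ∈ ϑ(y)`. The notion is used for compatible `ϑ`, where all words in `ϑ(y₀)` have the same
length `|ϑ(y₀)|`, so that the bound on `k` may be written with all of them. -/
def Recognisable : Prop :=
  ∀ x ∈ θ.seqSet, ∃! yk : (ℤ → A) × ℕ,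
    yk.1 ∈ θ.seqSet ∧ (∀ w ∈ θ.words (yk.1 0), yk.2 < w.length) ∧
      shift (-(yk.2 : ℤ)) x ∈ θ.onSeq yk.1

end RandomSubstitution

/-! By non-degeneracy some letter `a` has two distinct realisations, giving two tiles `z ≠ o` of the
same letter. By recognisability a point of `X_ϑ` is the same thing as a sequence of tiles whose
letters form a point of `X_ϑ`, with an origin inside the tile of index `0` (`Suspension.homeo`).
Compatibility gives all realisations of a letter the same length. Exchanging tiles for others of the
same letter therefore keeps the point in the suspension and moves no tile boundary, so a continuous
shift-commuting, letter-preserving map of tile sequences induces an endomorphism of `X_ϑ`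
(`Suspension.lift_next`).

Such maps come from the occurrences of `a`. By primitivity, recognisability and compatibility these
are unbounded in both directions in every point of `X_ϑ` (`Recognisable.biUnbounded_of_level`). The
tiles found there, listed in order, form a bi-infinite sequence that may be altered freely among the
realisations of `a`. An action on sequences of tiles is applied to this subsequence
(`InducedAction.fn`).

Since `a` may have more than two realisations, `Aut(X₂)` must first act on a larger full shift while
changing only the symbols `z` and `o`. Conveyor belts do this. Non-overlapping cells carry two data
bits, one on each of two tracks; maximal runs of adjacent cells are traversed rightwards above and
leftwards below, turning round at the ends. Finite runs give cycles, hence periodic binary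
sequences. The automorphism acts on the sequence read along each belt and leaves the cells in place
(`cell_beltFun_iff`), so composition is respected.

Faithfulness follows by writing a sequence moved by the automorphism on an endless belt
(`exists_beltFun_ne`), and that belt on the occurrences of `a` in some point of `X_ϑ`
(`InducedAction.exists_fn_ne`). Such a point exists by compactness
(`seqSet_nonempty_of_long_legal`). -/

/-! ### Continuity of families of permutations -/

section Continuity

variable {Y D Z : Type*} [TopologicalSpace Y] [TopologicalSpace D] [DiscreteTopology D]
  [TopologicalSpace Z]

/-- The index `d y` is locally constant, so it can be frozen near each point. -/
theorem continuous_eval_of_discrete {g : Y → D → Z} {d : Y → D}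
    (hg : ∀ d, Continuous fun y => g y d) (hd : Continuous d) :
    Continuous fun y => g y (d y) := by
  rw [continuous_iff_continuousAt]
  intro y
  have h : ∀ᶠ y' in nhds y, g y' (d y') = g y' (d y) := by
    filter_upwards [hd.continuousAt.eventually (IsOpen.mem_nhds (isOpen_discrete {d y}) rfl)]
      with y' hy'
    rw [show d y' = d y from hy']
  exact ((hg (d y)).continuousAt).congr (h.mono fun _ h => h.symm)

theorem continuous_perm_zpow_apply {T : Y → Equiv.Perm D}
    (h : ∀ d, Continuous fun y => T y d) (h' : ∀ d, Continuous fun y => (T y)⁻¹ d)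
    (n : ℤ) (d : D) : Continuous fun y => (T y ^ n) d := by
  induction n using Int.induction_on with
  | zero => simpa using continuous_const
  | succ n ih =>
    simp only [add_comm (n : ℤ) 1, zpow_one_add, Equiv.Perm.mul_apply]
    exact continuous_eval_of_discrete (g := fun y d => T y d) h ih
  | pred n ih =>
    simp only [show -(n : ℤ) - 1 = -1 + -n by ring, zpow_add, zpow_neg_one,
      Equiv.Perm.mul_apply]
    exact continuous_eval_of_discrete (g := fun y d => (T y)⁻¹ d) h' ih

theorem Continuous.ite_of_isClopen {p : Y → Prop} [DecidablePred p] {f g : Y → Z}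
    (hp : IsClopen {y | p y}) (hf : Continuous f) (hg : Continuous g) :
    Continuous fun y => if p y then f y else g y :=
  hf.if (by simp [hp.frontier_eq]) hg

theorem isClopen_setOf_of_continuous {f : Y → D} (hf : Continuous f) (p : D → Prop) :
    IsClopen {y | p (f y)} :=
  (isClopen_discrete {d | p d}).preimage hf

end Continuity

/-! ### Actions by cellular automata on a full shift -/

/-- The sequence of labels read along an orbit of a permutation. -/
def orbitSeq {D S : Type*} (T : Equiv.Perm D) (v : D → S) (d : D) : ℤ → S :=
  fun n => v ((T ^ n) d)

theorem orbitSeq_zpow {D S : Type*} (T : Equiv.Perm D) (v : D → S) (d : D) (n : ℤ) :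
    orbitSeq T v ((T ^ n) d) = shift n (orbitSeq T v d) := by
  ext m
  simp [orbitSeq, shift, ← Equiv.Perm.mul_apply, ← zpow_add, add_comm]

theorem orbitSeq_zero {D S : Type*} (T : Equiv.Perm D) (v : D → S) (d : D) :
    orbitSeq T v d 0 = v d := by simp [orbitSeq]

/-- Serves for shift-equivariance: shifting a configuration conjugates its motion by a translation
of the positions. -/
theorem orbitSeq_conj {D D' S : Type*} {T : Equiv.Perm D} {T' : Equiv.Perm D'} {v : D → S}
    {v' : D' → S} (e : D ≃ D') (hT : ∀ d, e (T d) = T' (e d)) (hv : ∀ d, v d = v' (e d))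
    (d : D) : orbitSeq T v d = orbitSeq T' v' (e d) := by
  have h : T' = e.permCongr T := by
    ext x; simp [Equiv.permCongr_apply, hT]
  have h2 : ∀ n : ℤ, T' ^ n = e.permCongr (T ^ n) := by
    intro n
    rw [h]
    exact (map_zpow e.permCongrHom T n).symm
  ext n
  simp [orbitSeq, h2, hv, Equiv.permCongr_apply]

/-- An action of a monoid on a full shift by continuous maps commuting with the shift. -/
structure ShiftAction (Γ : Type*) [Monoid Γ] (S : Type*) [TopologicalSpace S] where
  act : Γ → (ℤ → S) → ℤ → S
  continuous_act : ∀ g, Continuous (act g)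
  one_act : ∀ u, act 1 u = u
  mul_act : ∀ g h u, act (g * h) u = act g (act h u)
  act_shift_one : ∀ g u, act g (shift 1 u) = shift 1 (act g u)

namespace ShiftAction

variable {Γ : Type*} [Monoid Γ] {S : Type*} [TopologicalSpace S] (α : ShiftAction Γ S)

theorem act_shift (g : Γ) (n : ℤ) (u : ℤ → S) : α.act g (shift n u) = shift n (α.act g u) := by
  have key : ∀ (n : ℤ) (u : ℤ → S), shift (n + 1) u = shift 1 (shift n u) :=
    fun n u => shift_add n 1 u
  induction n using Int.induction_on with
  | zero => simp
  | succ n ih => rw [key, key, α.act_shift_one, ih]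
  | pred n ih =>
    -- Negative exponents are reached by cancelling one shift on both sides.
    have inj : Function.Injective (shift (A := S) (1 : ℤ)) := by
      intro x y h
      ext i
      simpa [shift] using congrFun h (i - 1)
    apply inj
    rw [← α.act_shift_one, ← key, ← key]
    simpa using ih

/-- Labels transformed along orbits by `α g` are read along orbits as the image under `α g`. -/
theorem orbitSeq_eq_act {D : Type*} {T : Equiv.Perm D} {v v' : D → S} {g : Γ} {d : D}
    (h : ∀ n : ℤ, v' ((T ^ n) d) = α.act g (orbitSeq T v ((T ^ n) d)) 0) :
    orbitSeq T v' d = α.act g (orbitSeq T v d) := by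
  ext n
  rw [show orbitSeq T v' d n = v' ((T ^ n) d) from rfl, h, orbitSeq_zpow, α.act_shift]
  simp [shift]

theorem continuous_act_orbitSeq {Y D : Type*} [TopologicalSpace Y] [TopologicalSpace D]
    [DiscreteTopology D] {T : Y → Equiv.Perm D} {v : Y → D → S}
    (h : ∀ d, Continuous fun y => T y d) (h' : ∀ d, Continuous fun y => (T y)⁻¹ d)
    (hv : ∀ d, Continuous fun y => v y d) (g : Γ) (d : D) (n : ℤ) :
    Continuous fun y => α.act g (orbitSeq (T y) (v y) d) n := by
  refine (continuous_apply n).comp ((α.continuous_act g).comp (continuous_pi fun m => ?_))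
  exact continuous_eval_of_discrete (g := v) hv (continuous_perm_zpow_apply h h' m d)

end ShiftAction

/-! ### Conveyor belts -/

namespace ConveyorBelt

variable {W : Type*} (z o : W)

/-- A cell starts at `q`: the word `z z o b o b' o` with data `b, b' ∈ {z, o}` is read there. -/
def Cell (c : ℤ → W) (q : ℤ) : Prop :=
  c q = z ∧ c (q + 1) = z ∧ c (q + 2) = o ∧ (c (q + 3) = z ∨ c (q + 3) = o) ∧ c (q + 4) = o ∧
    (c (q + 5) = z ∨ c (q + 5) = o) ∧ c (q + 6) = o

variable {z o}

/-- In `z z o b o b' o` two adjacent `z` occur only at the start: each later adjacent pair contains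
the `o` at offset 2, 4 or 6, and offset 6 itself cannot be a first letter. -/
theorem Cell.not_overlap (hzo : z ≠ o) {c : ℤ → W} {q d : ℤ} (h : Cell z o c q)
    (hd : 0 < d) (hd' : d < 7) : ¬ Cell z o c (q + d) := by
  rintro ⟨h1', h2', h3', h4', h5', h6', h7'⟩
  obtain ⟨h1, h2, h3, h4, h5, h6, h7⟩ := h
  have e : ∀ a b : ℤ, q + a + b = q + (a + b) := fun a b => add_assoc _ _ _
  interval_cases d <;> simp only [e] at * <;> norm_num at * <;> simp_all

theorem Cell.eq_of_lt (hzo : z ≠ o) {c : ℤ → W} {q q' : ℤ} (h : Cell z o c q)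
    (h' : Cell z o c q') (h1 : q' < q + 7) (h2 : q < q' + 7) : q = q' := by
  rcases lt_trichotomy q q' with hlt | rfl | hlt
  · exact absurd (by simpa using h') (h.not_overlap hzo (d := q' - q) (by omega) (by omega))
  · rfl
  · exact absurd (by simpa using h) (h'.not_overlap hzo (d := q - q') (by omega) (by omega))

variable (z o)

/-- Two consecutive cells. -/
def Link (c : ℤ → W) (q : ℤ) : Prop := Cell z o c q ∧ Cell z o c (q + 7)

open Classical in
/-- The junctions of the conveyor belts: the lower track of a cell is joined to the upper track
of the next cell, if there is one. -/
noncomputable def junctionFun (c : ℤ → W) (d : ℤ × Bool) : ℤ × Bool :=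
  if d.2 then (if Link z o c (d.1 - 7) then (d.1 - 7, false) else d)
  else (if Link z o c d.1 then (d.1 + 7, true) else d)

/-- Makes `belt` a permutation, as a product of two involutions. Under `belt` the upper track
(`true`) runs to the right, the lower one to the left, and at an end of a run the track is changed.
-/
theorem junctionFun_involutive (c : ℤ → W) : Function.Involutive (junctionFun z o c) := by
  rintro ⟨q, _ | _⟩ <;> simp only [junctionFun] <;> split_ifs <;> simp_all

/-- Exchange of the two tracks. -/
def flip : Equiv.Perm (ℤ × Bool) := Function.Involutive.toPerm (fun d => (d.1, !d.2))
  (fun d => by simp)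

/-- The motion along the conveyor belts. -/
noncomputable def belt (c : ℤ → W) : Equiv.Perm (ℤ × Bool) :=
  (junctionFun_involutive z o c).toPerm * flip

theorem belt_apply (c : ℤ → W) (d : ℤ × Bool) :
    belt z o c d = junctionFun z o c (d.1, !d.2) := rfl

/-- The route depends on the places of the cells only, not on their data. -/
theorem belt_congr {c c' : ℤ → W} (h : ∀ q, Cell z o c q ↔ Cell z o c' q) :
    belt z o c = belt z o c' := by
  have h' : Link z o c = Link z o c' := funext fun q => propext (and_congr (h q) (h (q + 7)))
  ext1 d
  simp only [belt_apply, junctionFun]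
  rw [h']

theorem cell_belt_iff (c : ℤ → W) (d : ℤ × Bool) :
    Cell z o c (belt z o c d).1 ↔ Cell z o c d.1 := by
  obtain ⟨q, _ | _⟩ := d
  · by_cases h : Link z o c (q - 7)
    · simp only [belt_apply, junctionFun, h, Bool.not_false, if_true, h.1, true_iff]
      simpa using h.2
    · simp [belt_apply, junctionFun, h]
  · by_cases h : Link z o c q
    · simp [belt_apply, junctionFun, h, h.1, h.2]
    · simp [belt_apply, junctionFun, h]

theorem cell_belt_zpow_iff (c : ℤ → W) (d : ℤ × Bool) (n : ℤ) :
    Cell z o c ((belt z o c ^ n) d).1 ↔ Cell z o c d.1 := by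
  induction n using Int.induction_on with
  | zero => simp
  | succ n ih => rw [add_comm, zpow_one_add, Equiv.Perm.mul_apply, cell_belt_iff, ih]
  | pred n ih =>
    rw [← ih, ← cell_belt_iff, ← Equiv.Perm.mul_apply, ← zpow_one_add]
    simp

theorem cell_shift (c : ℤ → W) (q : ℤ) : Cell z o (shift 1 c) q ↔ Cell z o c (1 + q) := by
  simp only [Cell, shift_apply, add_assoc]

theorem link_shift (c : ℤ → W) (q : ℤ) : Link z o (shift 1 c) q = Link z o c (1 + q) := by
  simp [Link, cell_shift, add_assoc]

theorem belt_shift (c : ℤ → W) (d : ℤ × Bool) :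
    ((Equiv.addLeft (1 : ℤ)).prodCongr (Equiv.refl Bool)) (belt z o (shift 1 c) d) =
      belt z o c (((Equiv.addLeft (1 : ℤ)).prodCongr (Equiv.refl Bool)) d) := by
  obtain ⟨q, _ | _⟩ := d
  · have e := link_shift z o c (q - 7)
    by_cases h : Link z o c (1 + (q - 7)) <;>
      simp [belt_apply, junctionFun, e, h, add_sub_assoc]
  · have e := link_shift z o c q
    by_cases h : Link z o c (1 + q) <;> simp [belt_apply, junctionFun, e, h, add_assoc]

open Classical in
/-- Reading a bit. -/
noncomputable def bit (w : W) : Fin 2 := if w = o then 1 else 0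

/-- Writing a bit. -/
def enc (b : Fin 2) : W := if b = 1 then o else z

theorem bit_enc (hzo : z ≠ o) (b : Fin 2) : bit o (enc z o b) = b := by
  fin_cases b <;> simp [bit, enc, hzo]

theorem enc_eq_or (b : Fin 2) : enc z o b = z ∨ enc z o b = o := by
  unfold enc; split_ifs <;> simp

theorem enc_bit {w : W} (h : w = z ∨ w = o) : enc z o (bit o w) = w := by
  by_cases hw : w = o
  · simp [bit, enc, hw]
  · simpa [bit, enc, hw] using (h.resolve_right hw).symm

/-- The position of a datum of a cell. -/
def pos (d : ℤ × Bool) : ℤ := d.1 + if d.2 then 3 else 5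

/-- The bits on the tracks. -/
noncomputable def label (c : ℤ → W) (d : ℤ × Bool) : Fin 2 := bit o (c (pos d))

/-- The configuration on a conveyor belt, unrolled. -/
noncomputable def unroll (c : ℤ → W) (d : ℤ × Bool) : ℤ → Fin 2 :=
  orbitSeq (belt z o c) (label o c) d

theorem Cell.data {c : ℤ → W} {d : ℤ × Bool} (h : Cell z o c d.1) :
    c (pos d) = z ∨ c (pos d) = o := by
  obtain ⟨q, _ | _⟩ := d
  · simpa [pos] using h.2.2.2.2.2.1
  · simpa [pos] using h.2.2.2.1

/-! ### Acting on the data bits of the cells -/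

variable {Γ : Type*} [Monoid Γ] (α : ShiftAction Γ (Fin 2))

open Classical in
/-- The action of `Γ` on the data of the conveyor belts. -/
noncomputable def beltFun (g : Γ) (c : ℤ → W) (x : ℤ) : W :=
  if Cell z o c (x - 3) then enc z o (α.act g (unroll z o c (x - 3, true)) 0)
  else if Cell z o c (x - 5) then enc z o (α.act g (unroll z o c (x - 5, false)) 0)
  else c x

theorem beltFun_pos (hzo : z ≠ o) (g : Γ) {c : ℤ → W} {d : ℤ × Bool} (h : Cell z o c d.1) :
    beltFun z o α g c (pos d) = enc z o (α.act g (unroll z o c d) 0) := by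
  obtain ⟨q, _ | _⟩ := d
  · have h' : ¬ Cell z o c (q + 2) := h.not_overlap hzo (by omega) (by omega)
    simp only at h
    simp [beltFun, pos, h, h', add_sub_assoc]
  · simp only at h
    simp [beltFun, pos, h]

theorem beltFun_of_forall_ne (g : Γ) {c : ℤ → W} {x : ℤ}
    (h : ∀ d : ℤ × Bool, Cell z o c d.1 → x ≠ pos d) : beltFun z o α g c x = c x := by
  have h1 : ¬ Cell z o c (x - 3) := fun hc => h (x - 3, true) hc (by simp [pos])
  have h2 : ¬ Cell z o c (x - 5) := fun hc => h (x - 5, false) hc (by simp [pos])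
  simp [beltFun, h1, h2]

theorem beltFun_eq_or (hzo : z ≠ o) (g : Γ) (c : ℤ → W) (x : ℤ) :
    beltFun z o α g c x = c x ∨ ((c x = z ∨ c x = o) ∧
      (beltFun z o α g c x = z ∨ beltFun z o α g c x = o)) := by
  by_cases h : ∀ d : ℤ × Bool, Cell z o c d.1 → x ≠ pos d
  · exact Or.inl (beltFun_of_forall_ne z o α g h)
  · push Not at h
    obtain ⟨d, hd, rfl⟩ := h
    rw [beltFun_pos z o α hzo g hd]
    exact Or.inr ⟨hd.data, enc_eq_or z o _⟩

theorem Cell.beltFun (hzo : z ≠ o) (g : Γ) {c : ℤ → W} {q : ℤ} (h : Cell z o c q) :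
    Cell z o (beltFun z o α g c) q := by
  have hne : ∀ r : ℤ, 0 ≤ r → r < 7 → r ≠ 3 → r ≠ 5 →
      ConveyorBelt.beltFun z o α g c (q + r) = c (q + r) := by
    intro r h0 h7 h3 h5
    refine beltFun_of_forall_ne z o α g fun d hd hp => ?_
    obtain ⟨q', _ | _⟩ := d <;> simp [pos] at hp hd <;>
      (have := h.eq_of_lt hzo hd (by omega) (by omega); omega)
  have h3 := beltFun_pos z o α hzo g (d := (q, true)) h
  have h5 := beltFun_pos z o α hzo g (d := (q, false)) h
  have h0 := hne 0 (by omega) (by omega) (by omega) (by omega)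
  simp only [pos, if_true, add_zero] at h3 h5 h0
  simp only [Bool.false_eq_true, if_false] at h5
  obtain ⟨c0, c1, c2, c3, c4, c5, c6⟩ := h
  refine ⟨?_, ?_, ?_, ?_, ?_, ?_, ?_⟩
  · rw [h0, c0]
  · rw [hne 1 (by omega) (by omega) (by omega) (by omega), c1]
  · rw [hne 2 (by omega) (by omega) (by omega) (by omega), c2]
  · rw [h3]; exact enc_eq_or z o _
  · rw [hne 4 (by omega) (by omega) (by omega) (by omega), c4]
  · rw [h5]; exact enc_eq_or z o _
  · rw [hne 6 (by omega) (by omega) (by omega) (by omega), c6]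

/-- Old cells survive because only data bits are rewritten, by `z` or `o`. A cell created at a new
place could not overlap a surviving one, so nothing in its window has changed and it was there
before. -/
theorem cell_beltFun_iff (hzo : z ≠ o) (g : Γ) (c : ℤ → W) (q : ℤ) :
    Cell z o c q ↔ Cell z o (beltFun z o α g c) q := by
  refine ⟨fun h => h.beltFun z o α hzo g, fun h => ?_⟩
  by_contra hq
  have hne : ∀ r : ℤ, 0 ≤ r → r < 7 → beltFun z o α g c (q + r) = c (q + r) := by
    intro r h0 h7
    refine beltFun_of_forall_ne z o α g fun d hd hp => ?_
    have hd' := hd.beltFun z o α hzo g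
    obtain ⟨q', _ | _⟩ := d <;> simp [pos] at hp hd hd' <;>
      (have := h.eq_of_lt hzo hd' (by omega) (by omega); subst this; exact hq hd)
  have h0 := hne 0 (by omega) (by omega)
  rw [add_zero] at h0
  apply hq
  rwa [Cell, h0, hne 1 (by omega) (by omega), hne 2 (by omega) (by omega),
    hne 3 (by omega) (by omega), hne 4 (by omega) (by omega), hne 5 (by omega) (by omega),
    hne 6 (by omega) (by omega)] at h

/-- The belt itself is unchanged, so the coordinatewise rewriting amounts to applying `α g` to the
whole unrolled sequence. This gives multiplicativity. -/
theorem unroll_beltFun (hzo : z ≠ o) (g : Γ) {c : ℤ → W} {d : ℤ × Bool} (h : Cell z o c d.1) :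
    unroll z o (beltFun z o α g c) d = α.act g (unroll z o c d) := by
  rw [unroll, ← belt_congr z o (cell_beltFun_iff z o α hzo g c)]
  refine α.orbitSeq_eq_act fun n => ?_
  rw [label, beltFun_pos z o α hzo g ((cell_belt_zpow_iff z o c d n).2 h), bit_enc z o hzo]
  rfl

theorem unroll_shift (c : ℤ → W) (q : ℤ) (b : Bool) :
    unroll z o (shift 1 c) (q, b) = unroll z o c (1 + q, b) :=
  orbitSeq_conj ((Equiv.addLeft (1 : ℤ)).prodCongr (Equiv.refl Bool)) (belt_shift z o c)
    (fun d => by simp [label, pos, shift, add_assoc]) (q, b)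

theorem beltFun_one (c : ℤ → W) (hzo : z ≠ o) : beltFun z o α 1 c = c := by
  ext x
  by_cases h : ∀ d : ℤ × Bool, Cell z o c d.1 → x ≠ pos d
  · exact beltFun_of_forall_ne z o α 1 h
  · push Not at h
    obtain ⟨d, hd, rfl⟩ := h
    rw [beltFun_pos z o α hzo 1 hd, α.one_act, unroll, orbitSeq_zero, label, enc_bit z o hd.data]

theorem beltFun_mul (hzo : z ≠ o) (g h : Γ) (c : ℤ → W) :
    beltFun z o α (g * h) c = beltFun z o α g (beltFun z o α h c) := by
  have hc := cell_beltFun_iff z o α hzo h c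
  ext x
  by_cases hx : ∀ d : ℤ × Bool, Cell z o c d.1 → x ≠ pos d
  · rw [beltFun_of_forall_ne z o α _ hx, beltFun_of_forall_ne z o α g,
      beltFun_of_forall_ne z o α h hx]
    exact fun d hd => hx d ((hc _).2 hd)
  · push Not at hx
    obtain ⟨d, hd, rfl⟩ := hx
    rw [beltFun_pos z o α hzo _ hd, beltFun_pos z o α hzo _ ((hc _).1 hd),
      unroll_beltFun z o α hzo h hd, α.mul_act]

theorem beltFun_shift (g : Γ) (c : ℤ → W) :
    beltFun z o α g (shift 1 c) = shift 1 (beltFun z o α g c) := by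
  ext x
  classical
  simp only [beltFun, unroll_shift, shift_apply, ← add_sub_assoc]
  have e : ∀ y, Cell z o (shift 1 c) (x - y) ↔ Cell z o c (1 + x - y) := fun y => by
    rw [cell_shift, add_sub_assoc]
  exact if_congr (e 3) rfl (if_congr (e 5) rfl rfl)

/-- A conveyor belt without ends that carries `u`. -/
def endless (u : ℤ → Fin 2) (x : ℤ) : W :=
  if x % 7 = 3 then enc z o (u (x / 7)) else if x % 7 = 0 ∨ x % 7 = 1 then z else o

theorem cell_endless (u : ℤ → Fin 2) (q : ℤ) : Cell z o (endless z o u) (7 * q) := by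
  have h : ∀ r : ℤ, (7 * q + r) % 7 = r % 7 := fun r => by omega
  have h0 : (7 * q) % 7 = 0 := by omega
  simp [Cell, endless, h, h0, enc_eq_or]

/-- Every cell has a right neighbour, so the motion never leaves the upper track and meets the bits
of `u` in order. -/
theorem unroll_endless (hzo : z ≠ o) (u : ℤ → Fin 2) :
    unroll z o (endless z o u) (0, true) = u := by
  have hstep : ∀ q : ℤ, belt z o (endless z o u) (7 * q, true) = (7 * (q + 1), true) := by
    intro q
    have h : Link z o (endless z o u) (7 * q) := ⟨cell_endless z o u q, by
      simpa [mul_add] using cell_endless z o u (q + 1)⟩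
    simp [belt_apply, junctionFun, h, mul_add]
  have hn : ∀ n : ℤ, (belt z o (endless z o u) ^ n) (0, true) = (7 * n, true) := by
    intro n
    induction n using Int.induction_on with
    | zero => simp
    | succ n ih => rw [add_comm, zpow_one_add, Equiv.Perm.mul_apply, ih, hstep, add_comm]
    | pred n ih =>
      apply (belt z o (endless z o u)).injective
      rw [hstep, ← Equiv.Perm.mul_apply, ← zpow_one_add]
      simpa using ih
  ext n
  have h1 : (7 * n + 3) % 7 = 3 := by omega
  have h2 : (7 * n + 3) / 7 = n := by omega
  simp [unroll, orbitSeq, hn, label, pos, endless, h1, h2, bit_enc z o hzo]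

theorem exists_beltFun_ne (hzo : z ≠ o) {g : Γ} {u : ℤ → Fin 2} (h : α.act g u ≠ u) :
    ∃ c : ℤ → W, (∀ x, c x = z ∨ c x = o) ∧ beltFun z o α g c ≠ c := by
  obtain ⟨n, hn⟩ := Function.ne_iff.1 h
  -- The shift by `n` brings a coordinate where `u` is changed to the origin.
  refine ⟨endless z o (shift n u), fun x => ?_, fun hc => hn ?_⟩
  · unfold endless
    split_ifs
    exacts [enc_eq_or z o _, Or.inl rfl, Or.inr rfl]
  · have hcell : Cell z o (endless z o (shift n u)) (0, true).1 := by
      simpa using cell_endless z o (shift n u) 0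
    have := unroll_beltFun z o α hzo g hcell
    rw [hc, unroll_endless z o hzo, α.act_shift] at this
    simpa [shift] using congrFun this.symm 0

/-! ### Continuity of the conveyor belt action -/

variable [TopologicalSpace W] [DiscreteTopology W]

theorem isClopen_cell (q : ℤ) : IsClopen {c : ℤ → W | Cell z o c q} := by
  have h : ∀ (p : W → Prop) (r : ℤ), IsClopen {c : ℤ → W | p (c r)} := fun p r =>
    isClopen_setOf_of_continuous (f := fun c : ℤ → W => c r) (continuous_apply r) p
  exact (h (· = z) _).inter ((h (· = z) _).inter ((h (· = o) _).inter
    ((h (fun w => w = z ∨ w = o) _).inter ((h (· = o) _).inter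
    ((h (fun w => w = z ∨ w = o) _).inter (h (· = o) _))))))

theorem isClopen_link (q : ℤ) : IsClopen {c : ℤ → W | Link z o c q} :=
  (isClopen_cell z o q).inter (isClopen_cell z o (q + 7))

theorem continuous_junctionFun (d : ℤ × Bool) :
    Continuous fun c : ℤ → W => junctionFun z o c d := by
  classical
  obtain ⟨q, _ | _⟩ := d
  · have h := (continuous_const (y := (q + 7, true))).ite_of_isClopen (isClopen_link z o q)
      (continuous_const (y := (q, false)))
    exact h
  · have h := (continuous_const (y := (q - 7, false))).ite_of_isClopen
      (isClopen_link z o (q - 7)) (continuous_const (y := (q, true)))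
    exact h

theorem continuous_act_unroll (g : Γ) (d : ℤ × Bool) (n : ℤ) :
    Continuous fun c : ℤ → W => α.act g (unroll z o c d) n := by
  refine α.continuous_act_orbitSeq (fun d => ?_) (fun d => ?_) (fun d => ?_) g d n
  · exact continuous_junctionFun z o _
  -- The inverse of `belt` is the same two involutions composed in the other order.
  · exact (continuous_of_discreteTopology (f := fun d : ℤ × Bool => (d.1, !d.2))).comp
      (continuous_junctionFun z o d)
  · exact (continuous_of_discreteTopology (f := bit o)).comp (continuous_apply (pos d))

theorem continuous_beltFun (g : Γ) : Continuous (beltFun z o α g) := by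
  classical
  refine continuous_pi fun x => ?_
  have he : Continuous (enc z o) := continuous_of_discreteTopology
  exact (he.comp (continuous_act_unroll z o α g _ 0)).ite_of_isClopen (isClopen_cell z o _)
    ((he.comp (continuous_act_unroll z o α g _ 0)).ite_of_isClopen (isClopen_cell z o _)
      (continuous_apply x))

/-- The action on the full shift over `W` induced by an action on the full shift over two letters,
by way of conveyor belts. -/
noncomputable def action (hzo : z ≠ o) : ShiftAction Γ W where
  act := beltFun z o α
  continuous_act := continuous_beltFun z o α
  one_act c := beltFun_one z o α c hzo
  mul_act := beltFun_mul z o α hzo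
  act_shift_one := beltFun_shift z o α

end ConveyorBelt

/-! ### Inducing an action on the occurrences of a letter -/

/-- A set of integers that is unbounded in both directions. -/
def BiUnbounded (P : Set ℤ) : Prop := ∀ N : ℤ, (∃ j ∈ P, N < j) ∧ ∃ j ∈ P, j < N

/-- `j` is the successor of `i` in `P`, or `j = i` does not belong to `P`. -/
def NextRel (P : Set ℤ) (i j : ℤ) : Prop :=
  (i ∈ P ∧ j ∈ P ∧ i < j ∧ ∀ l, i < l → l < j → l ∉ P) ∨ (i ∉ P ∧ i = j)

namespace NextRel

variable {P : Set ℤ}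

theorem right_unique {i j j' : ℤ} (h : NextRel P i j) (h' : NextRel P i j') : j = j' := by
  rcases h with ⟨hi, hj, hij, h⟩ | ⟨hi, rfl⟩ <;> rcases h' with ⟨hi', hj', hij', h'⟩ | ⟨hi', rfl⟩
  · rcases lt_trichotomy j j' with hlt | e | hlt
    exacts [absurd hj (h' j hij hlt), e, absurd hj' (h j' hij' hlt)]
  · exact absurd hi hi'
  · exact absurd hi' hi
  · rfl

theorem left_unique {i i' j : ℤ} (h : NextRel P i j) (h' : NextRel P i' j) : i = i' := by
  rcases h with ⟨hi, hj, hij, h⟩ | ⟨hi, rfl⟩ <;> rcases h' with ⟨hi', hj', hij', h'⟩ | ⟨hi', rfl⟩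
  · rcases lt_trichotomy i i' with hlt | e | hlt
    exacts [absurd hi' (h i' hlt hij'), e, absurd hi (h' i hlt hij)]
  · exact absurd hj hi'
  · exact absurd hj' hi
  · rfl

theorem exists_right (hP : BiUnbounded P) (i : ℤ) : ∃ j, NextRel P i j := by
  by_cases hi : i ∈ P
  · obtain ⟨j, hj, hmin⟩ := Int.exists_least_of_bdd (P := fun j => j ∈ P ∧ i < j)
      ⟨i, fun j hj => hj.2.le⟩ (hP i).1
    exact ⟨j, Or.inl ⟨hi, hj.1, hj.2, fun l hl hlj hlP => absurd (hmin l ⟨hlP, hl⟩) (by omega)⟩⟩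
  · exact ⟨i, Or.inr ⟨hi, rfl⟩⟩

theorem exists_left (hP : BiUnbounded P) (j : ℤ) : ∃ i, NextRel P i j := by
  by_cases hj : j ∈ P
  · obtain ⟨i, hi, hmax⟩ := Int.exists_greatest_of_bdd (P := fun i => i ∈ P ∧ i < j)
      ⟨j, fun i hi => hi.2.le⟩ (hP j).2
    exact ⟨i, Or.inl ⟨hi.1, hj, hi.2, fun l hl hlj hlP => absurd (hmax l ⟨hlP, hlj⟩) (by omega)⟩⟩
  · exact ⟨j, Or.inr ⟨hj, rfl⟩⟩

theorem add_left_iff {m i j : ℤ} :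
    NextRel P (m + i) (m + j) ↔ NextRel {l | m + l ∈ P} i j := by
  have h : (∀ l, m + i < l → l < m + j → l ∉ P) ↔ ∀ l, i < l → l < j → m + l ∉ P :=
    ⟨fun h l h1 h2 => h _ (by omega) (by omega), fun h l h1 h2 => by
      simpa using h (l - m) (by omega) (by omega)⟩
  simp [NextRel, h]

end NextRel

open Classical in
/-- The permutation that moves each element of `P` to its successor in `P`, and fixes the other
integers. -/
noncomputable def nextPerm (P : Set ℤ) : Equiv.Perm ℤ :=
  if hP : BiUnbounded P then
    { toFun := fun i => (NextRel.exists_right hP i).choose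
      invFun := fun j => (NextRel.exists_left hP j).choose
      left_inv := fun i => (NextRel.exists_left hP _).choose_spec.left_unique
        (NextRel.exists_right hP i).choose_spec
      right_inv := fun j => (NextRel.exists_right hP _).choose_spec.right_unique
        (NextRel.exists_left hP j).choose_spec }
  -- A default value; the facts about successors below assume `BiUnbounded P`.
  else 1

section nextPerm

variable {P : Set ℤ} (hP : BiUnbounded P)

include hP

theorem nextRel_nextPerm (i : ℤ) : NextRel P i (nextPerm P i) := by
  simp only [nextPerm, hP, dif_pos]
  exact (NextRel.exists_right hP i).choose_spec

theorem nextPerm_eq_iff {i j : ℤ} : nextPerm P i = j ↔ NextRel P i j :=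
  ⟨fun h => h ▸ nextRel_nextPerm hP i, fun h => (nextRel_nextPerm hP i).right_unique h⟩

theorem nextPerm_inv_eq_iff {i j : ℤ} : (nextPerm P)⁻¹ j = i ↔ NextRel P i j := by
  rw [Equiv.Perm.inv_eq_iff_eq, eq_comm, nextPerm_eq_iff hP]

theorem nextPerm_mem_iff (i : ℤ) : nextPerm P i ∈ P ↔ i ∈ P := by
  rcases nextRel_nextPerm hP i with ⟨h1, h2, -⟩ | ⟨h1, h2⟩
  · simp [h1, h2]
  · rw [← h2]

theorem nextPerm_zpow_mem_iff (i n : ℤ) : (nextPerm P ^ n) i ∈ P ↔ i ∈ P := by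
  induction n using Int.induction_on with
  | zero => simp
  | succ n ih => rw [add_comm, zpow_one_add, Equiv.Perm.mul_apply, nextPerm_mem_iff hP, ih]
  | pred n ih =>
    rw [← ih, ← nextPerm_mem_iff hP, ← Equiv.Perm.mul_apply, ← zpow_one_add]
    simp

/-- Orbits inside `P` strictly increase. Hence symbols can be prescribed independently along an
orbit. -/
theorem nextPerm_zpow_injective {i : ℤ} (hi : i ∈ P) :
    Function.Injective fun n : ℤ => (nextPerm P ^ n) i := by
  refine (strictMono_int_of_lt_succ fun n => ?_).injective
  rw [add_comm, zpow_one_add, Equiv.Perm.mul_apply]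
  rcases nextRel_nextPerm hP ((nextPerm P ^ n) i) with ⟨-, -, h, -⟩ | ⟨h, -⟩
  · exact h
  · exact absurd ((nextPerm_zpow_mem_iff hP i n).2 hi) h

theorem nextPerm_add_left (m i : ℤ) : m + nextPerm {l | m + l ∈ P} i = nextPerm P (m + i) := by
  have h : BiUnbounded {l | m + l ∈ P} := fun N => by
    obtain ⟨⟨j, hj, hj'⟩, l, hl, hl'⟩ := hP (m + N)
    exact ⟨⟨j - m, by simpa using hj, by omega⟩, l - m, by simpa using hl, by omega⟩
  rw [eq_comm, nextPerm_eq_iff hP, NextRel.add_left_iff]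
  exact nextRel_nextPerm h i

end nextPerm

/-- Whether `j` succeeds `i` is decided by the finitely many integers from `i` to `j`. -/
theorem isOpen_setOf_nextRel {Y : Type*} [TopologicalSpace Y] {P : Y → Set ℤ}
    (h : ∀ i, IsClopen {y | i ∈ P y}) (i j : ℤ) : IsOpen {y | NextRel (P y) i j} := by
  have h1 : IsOpen {y | ∀ l, i < l → l < j → l ∉ P y} := by
    have e : {y | ∀ l, i < l → l < j → l ∉ P y} =
        ⋂ l ∈ Finset.Ioo i j, {y | l ∈ P y}ᶜ := by
      ext y; simp
    rw [e]
    exact isOpen_biInter_finset fun l _ => (h l).compl.isOpen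
  exact ((h i).isOpen.inter ((h j).isOpen.inter
    ((isOpen_const (p := i < j)).inter h1))).union
    ((h i).compl.isOpen.inter (isOpen_const (p := i = j)))

/-! ### The action on the subsequence at the occurrences of a letter -/

namespace InducedAction

variable {S A : Type*} (κ : S → A) (a : A)

/-- The occurrences of `a`. -/
def occ (s : ℤ → S) : Set ℤ := {i | κ (s i) = a}

/-- The sequence of symbols at the occurrences of `a`, seen from the occurrence `i`. -/
noncomputable def subseq (s : ℤ → S) (i : ℤ) : ℤ → S := orbitSeq (nextPerm (occ κ a s)) s i

theorem subseq_zero (s : ℤ → S) (i : ℤ) : subseq κ a s i 0 = s i := orbitSeq_zero _ _ _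

variable {Γ : Type*} [Monoid Γ] [TopologicalSpace S] (α : ShiftAction Γ S)

open Classical in
/-- The action on the subsequence of symbols at occurrences of `a`. -/
noncomputable def fn (g : Γ) (s : ℤ → S) (i : ℤ) : S :=
  if κ (s i) = a then α.act g (subseq κ a s i) 0 else s i

variable {κ a}
variable (hα : ∀ g u i, κ (α.act g u i) = κ (u i))

theorem fn_of_eq (g : Γ) {s : ℤ → S} {i : ℤ} (h : κ (s i) = a) :
    fn κ a α g s i = α.act g (subseq κ a s i) 0 := by simp [fn, h]

theorem fn_of_ne (g : Γ) {s : ℤ → S} {i : ℤ} (h : κ (s i) ≠ a) :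
    fn κ a α g s i = s i := by simp [fn, h]

include hα in
theorem kind_fn (g : Γ) (s : ℤ → S) (i : ℤ) : κ (fn κ a α g s i) = κ (s i) := by
  by_cases h : κ (s i) = a
  · rw [fn_of_eq α g h, hα, subseq_zero]
  · rw [fn_of_ne α g h]

include hα in
theorem occ_fn (g : Γ) (s : ℤ → S) : occ κ a (fn κ a α g s) = occ κ a s := by
  ext i; simp [occ, kind_fn α hα]

theorem fn_one (s : ℤ → S) : fn κ a α 1 s = s := by
  ext i
  by_cases h : κ (s i) = a
  · rw [fn_of_eq α 1 h, α.one_act, subseq_zero]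
  · rw [fn_of_ne α 1 h]

variable {s : ℤ → S} (hs : BiUnbounded (occ κ a s))

include hα hs in
-- The occurrences of `a` are not moved, so the subsequence is read along the same orbit before and
-- after.
theorem subseq_fn (g : Γ) {i : ℤ} (h : κ (s i) = a) :
    subseq κ a (fn κ a α g s) i = α.act g (subseq κ a s i) := by
  rw [subseq, occ_fn α hα]
  refine α.orbitSeq_eq_act fun n => ?_
  exact fn_of_eq α g ((nextPerm_zpow_mem_iff hs i n).2 h)

include hα hs in
theorem fn_mul (g h : Γ) : fn κ a α (g * h) s = fn κ a α g (fn κ a α h s) := by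
  ext i
  by_cases hi : κ (s i) = a
  · rw [fn_of_eq α _ hi, fn_of_eq α g ((kind_fn α hα h s i).trans hi), subseq_fn α hα hs h hi,
      α.mul_act]
  · rw [fn_of_ne α _ hi, fn_of_ne α g ((kind_fn α hα h s i).trans_ne hi), fn_of_ne α h hi]

include hs in
theorem fn_shift (g : Γ) : fn κ a α g (shift 1 s) = shift 1 (fn κ a α g s) := by
  have h : ∀ i, subseq κ a (shift 1 s) i = subseq κ a s (1 + i) := fun i =>
    orbitSeq_conj (Equiv.addLeft (1 : ℤ)) (fun d => nextPerm_add_left hs 1 d) (fun _ => rfl) i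
  ext i
  simp only [fn, h, shift_apply]
  rfl

/-- On this subspace successors and predecessors are locally constant, so each entry of the
subsequence depends continuously on `s`. -/
theorem continuous_fn [DiscreteTopology S] (g : Γ) :
    Continuous fun s : {s : ℤ → S // BiUnbounded (occ κ a s)} => fn κ a α g s.1 := by
  classical
  have hc : ∀ i, Continuous fun s : {s : ℤ → S // BiUnbounded (occ κ a s)} => s.1 i :=
    fun i => (continuous_apply i).comp continuous_subtype_val
  have hcl : ∀ i, IsClopen {s : {s : ℤ → S // BiUnbounded (occ κ a s)} | i ∈ occ κ a s.1} :=
    fun i => isClopen_setOf_of_continuous (hc i) (fun t => κ t = a)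
  refine continuous_pi fun i => ?_
  have h1 := α.continuous_act_orbitSeq
    (T := fun s : {s : ℤ → S // BiUnbounded (occ κ a s)} => nextPerm (occ κ a s.1))
    (v := fun s => s.1) (fun d => ?_) (fun d => ?_) hc g i 0
  · exact h1.ite_of_isClopen (hcl i) (hc i)
  · refine continuous_discrete_rng.2 fun j => ?_
    convert isOpen_setOf_nextRel hcl d j using 1
    ext s
    exact nextPerm_eq_iff s.2
  · refine continuous_discrete_rng.2 fun j => ?_
    convert isOpen_setOf_nextRel hcl j d using 1
    ext s
    exact nextPerm_inv_eq_iff s.2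

include hs in
theorem exists_fn_ne {g : Γ} {u : ℤ → S} (hu : ∀ i, κ (u i) = a) (h : α.act g u ≠ u) :
    ∃ s' : ℤ → S, (∀ i, κ (s' i) = κ (s i)) ∧ fn κ a α g s' ≠ s' := by
  classical
  obtain ⟨m, hm⟩ := Function.ne_iff.1 h
  obtain ⟨i, hi, -⟩ := (hs 0).1
  set T := nextPerm (occ κ a s) with hT
  -- Writes `u` along the occurrences of `a`, with its coordinate `m`, where `α g` changes it, at
  -- the occurrence `i`.
  let s' : ℤ → S := fun j => if h : ∃ n : ℤ, (T ^ n) i = j then u (m + h.choose) else s j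
  have hs'T : ∀ n : ℤ, s' ((T ^ n) i) = u (m + n) := by
    intro n
    have hex : ∃ n' : ℤ, (T ^ n') i = (T ^ n) i := ⟨n, rfl⟩
    simp only [s', dif_pos hex]
    rw [nextPerm_zpow_injective hs hi hex.choose_spec]
  have hκ : ∀ j, κ (s' j) = κ (s j) := by
    intro j
    by_cases hj : ∃ n : ℤ, (T ^ n) i = j
    · obtain ⟨n, rfl⟩ := hj
      rw [hs'T, hu]
      exact ((nextPerm_zpow_mem_iff hs i n).2 hi).symm
    · simp only [s', dif_neg hj]
  refine ⟨s', hκ, fun he => hm ?_⟩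
  have hocc : occ κ a s' = occ κ a s := by ext j; simp [occ, hκ]
  have hsub : subseq κ a s' i = shift m u := by
    ext n
    simp only [subseq, hocc, orbitSeq, ← hT, hs'T, shift_apply]
  have := congrFun he i
  rw [fn_of_eq α g ((hκ i).trans hi), hsub, α.act_shift] at this
  simpa [shift, hs'T, show s' i = u m by simpa using hs'T 0] using this

end InducedAction

/-! ### Partial sums of bi-infinite sequences -/

/-- The sequence `c` with `c 0 = 0` and `c (i + 1) = c i + ℓ i`. -/
noncomputable def intSum (ℓ : ℤ → ℤ) (i : ℤ) : ℤ :=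
  ∑ j ∈ Finset.Ico 0 i, ℓ j - ∑ j ∈ Finset.Ico i 0, ℓ j

theorem intSum_zero (ℓ : ℤ → ℤ) : intSum ℓ 0 = 0 := by simp [intSum]

theorem intSum_succ (ℓ : ℤ → ℤ) (i : ℤ) : intSum ℓ (i + 1) = intSum ℓ i + ℓ i := by
  rcases le_or_gt 0 i with h | h
  · have e : Finset.Ico (i + 1) 0 = ∅ := Finset.Ico_eq_empty (by omega)
    have e' : Finset.Ico i 0 = ∅ := Finset.Ico_eq_empty (by omega)
    rw [intSum, intSum, e, e', ← Finset.insert_Ico_right_eq_Ico_add_one h,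
      Finset.sum_insert (by simp)]
    ring
  · have e : Finset.Ico 0 (i + 1) = ∅ := Finset.Ico_eq_empty (by omega)
    have e' : Finset.Ico 0 i = ∅ := Finset.Ico_eq_empty (by omega)
    rw [intSum, intSum, e, e', ← Finset.insert_Ico_add_one_left_eq_Ico h,
      Finset.sum_insert (by simp)]
    ring

theorem eq_of_increments_eq {c c' : ℤ → ℤ} {ℓ : ℤ → ℤ} (h0 : c 0 = c' 0)
    (h : ∀ i, c (i + 1) = c i + ℓ i) (h' : ∀ i, c' (i + 1) = c' i + ℓ i) : c = c' := by
  ext i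
  induction i using Int.induction_on with
  | zero => exact h0
  | succ n ih => rw [h, h', ih]
  | pred n ih =>
    have h1 := h (-n - 1)
    have h2 := h' (-n - 1)
    rw [sub_add_cancel] at h1 h2
    linarith

section Cover

variable {c : ℤ → ℤ} (hc : StrictMono c)

include hc

theorem StrictMono.add_sub_le {i j : ℤ} (h : i ≤ j) : c i + (j - i) ≤ c j := by
  have : Monotone fun i => c i - i := monotone_int_of_le_succ fun n => by
    have := hc (lt_add_one n); omega
  have := this h
  simp only at this
  omega

theorem StrictMono.exists_le_lt (m : ℤ) : ∃ i, c i ≤ m ∧ m < c (i + 1) := by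
  obtain ⟨i, hi, hmax⟩ := Int.exists_greatest_of_bdd (P := fun i => c i ≤ m)
    ⟨max 0 (m - c 0), fun i hi => by
      by_contra! h
      have := hc.add_sub_le (i := 0) (j := i) (by omega)
      omega⟩
    ⟨min 0 (m - c 0), by
      have := hc.add_sub_le (i := min 0 (m - c 0)) (j := 0) (by omega)
      omega⟩
  refine ⟨i, hi, ?_⟩
  by_contra! h
  have := hmax (i + 1) h
  omega

theorem StrictMono.eq_of_le_lt {m i i' : ℤ} (h1 : c i ≤ m) (h2 : m < c (i + 1)) (h1' : c i' ≤ m)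
    (h2' : m < c (i' + 1)) : i = i' := by
  have := hc.lt_iff_lt.1 (h1.trans_lt h2')
  have := hc.lt_iff_lt.1 (h1'.trans_lt h2)
  omega

end Cover

/-! ### Concatenations of tiles -/

namespace RandomSubstitution

variable {A : Type*} (θ : RandomSubstitution A)

/-- A letter together with one of its realisations. -/
@[ext] structure Tile where
  /-- The letter. -/
  typ : A
  /-- The realisation of the letter. -/
  word : List A
  mem : word ∈ θ.words typ

namespace Tile

variable {θ}

instance : TopologicalSpace θ.Tile := ⊥

instance : DiscreteTopology θ.Tile := ⟨rfl⟩

instance [Finite A] : Finite θ.Tile :=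
  Finite.of_injective (β := Σ a : A, θ.words a) (fun t => ⟨t.typ, t.word, t.mem⟩) (by
    rintro ⟨a, w, h⟩ ⟨a', w', h'⟩ e
    simp only [Sigma.mk.injEq] at e
    obtain ⟨rfl, e⟩ := e
    simpa using e)

/-- The length of a tile. -/
def len (t : θ.Tile) : ℕ := t.word.length

theorem len_pos (t : θ.Tile) : 0 < t.len :=
  List.length_pos_iff.2 fun h => θ.nil_notMem t.typ (h ▸ t.mem)

/-- The position at which the `i`-th tile starts. -/
noncomputable def start (s : ℤ → θ.Tile) : ℤ → ℤ := intSum fun j => (s j).len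

theorem start_zero (s : ℤ → θ.Tile) : start s 0 = 0 := intSum_zero _

theorem start_succ (s : ℤ → θ.Tile) (i : ℤ) : start s (i + 1) = start s i + (s i).len :=
  intSum_succ _ i

theorem eq_start {s : ℤ → θ.Tile} {c : ℤ → ℤ} (h0 : c 0 = 0)
    (h : ∀ i, c (i + 1) = c i + (s i).len) : c = start s :=
  eq_of_increments_eq (h0.trans (start_zero s).symm) h (start_succ s)

theorem start_strictMono (s : ℤ → θ.Tile) : StrictMono (start s) :=
  strictMono_int_of_lt_succ fun i => by
    rw [start_succ]; have := (s i).len_pos; omega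

theorem start_shift (s : ℤ → θ.Tile) (i : ℤ) :
    (s 0).len + start (shift 1 s) i = start s (i + 1) := by
  have h : (fun i => start s (i + 1) - (s 0).len) = start (shift 1 s) := by
    refine eq_start ?_ fun i => ?_
    · have := start_succ s 0
      rw [start_zero] at this
      omega
    · simp only [start_succ, shift_apply, add_comm 1 i]
      ring
  rw [← h]
  ring

theorem exists_position (s : ℤ → θ.Tile) (m : ℤ) :
    ∃ (i : ℤ) (j : ℕ), j < (s i).len ∧ start s i + j = m := by
  obtain ⟨i, h1, h2⟩ := (start_strictMono s).exists_le_lt m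
  rw [start_succ] at h2
  exact ⟨i, (m - start s i).toNat, by omega, by omega⟩

theorem position_unique (s : ℤ → θ.Tile) {i i' : ℤ} {j j' : ℕ} (hj : j < (s i).len)
    (hj' : j' < (s i').len) (h : start s i + j = start s i' + j') : i = i' ∧ j = j' := by
  have : i = i' := (start_strictMono s).eq_of_le_lt (m := start s i + j) (by omega)
    (by rw [start_succ]; omega) (by omega) (by rw [start_succ]; omega)
  subst this
  exact ⟨rfl, by omega⟩

theorem getElem_congr {t t' : θ.Tile} {j j' : ℕ} (ht : t = t') (hj : j = j')
    (h : j < t.word.length) (h' : j' < t'.word.length) : t.word[j] = t'.word[j'] := by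
  subst ht hj; rfl

/-- `x` is the concatenation of the sequence `s` of tiles. -/
def Realises (s : ℤ → θ.Tile) (x : ℤ → A) : Prop :=
  ∀ (i : ℤ) (j : ℕ) (hj : j < (s i).len), x (start s i + j) = (s i).word[j]'hj

theorem Realises.unique {s : ℤ → θ.Tile} {x x' : ℤ → A} (h : Realises s x)
    (h' : Realises s x') : x = x' := by
  ext m
  obtain ⟨i, j, hj, rfl⟩ := exists_position s m
  rw [h i j hj, h' i j hj]

/-- The concatenation of a bi-infinite sequence of tiles. -/
noncomputable def concat (s : ℤ → θ.Tile) (m : ℤ) : A :=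
  (s (exists_position s m).choose).word[(exists_position s m).choose_spec.choose]'
    (exists_position s m).choose_spec.choose_spec.1

theorem concat_realises (s : ℤ → θ.Tile) : Realises s (concat s) := by
  intro i j hj
  have h := (exists_position s (start s i + j)).choose_spec.choose_spec
  obtain ⟨h1, h2⟩ := position_unique s h.1 hj h.2
  exact getElem_congr (congrArg s h1) h2 _ _

theorem concat_shift (s : ℤ → θ.Tile) :
    concat (shift 1 s) = shift ((s 0).len : ℤ) (concat s) := by
  refine (concat_realises _).unique fun i j hj => ?_
  rw [shift_apply, ← add_assoc, start_shift, add_comm i 1]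
  exact concat_realises s (1 + i) j hj

theorem concat_mem_onSeq (s : ℤ → θ.Tile) : concat s ∈ θ.onSeq fun i => (s i).typ :=
  ⟨fun i => (s i).word, start s, fun i => (s i).mem, start_zero s, start_succ s,
    concat_realises s⟩

theorem exists_of_mem_onSeq {x y : ℤ → A} (h : x ∈ θ.onSeq y) :
    ∃ s : ℤ → θ.Tile, (∀ i, (s i).typ = y i) ∧ concat s = x := by
  obtain ⟨w, c, hw, h0, hc, hx⟩ := h
  refine ⟨fun i => ⟨y i, w i, hw i⟩, fun _ => rfl, (concat_realises _).unique fun i j hj => ?_⟩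
  rw [← eq_start (s := fun i => ⟨y i, w i, hw i⟩) h0 hc]
  exact hx i j hj

theorem continuous_start (i : ℤ) : Continuous fun s : ℤ → θ.Tile => start s i := by
  have h : ∀ j : ℤ, Continuous fun s : ℤ → θ.Tile => ((s j).len : ℤ) := fun j =>
    (continuous_of_discreteTopology (f := fun t : θ.Tile => (t.len : ℤ))).comp
      (continuous_apply j)
  exact (continuous_finsetSum _ fun j _ => h j).sub (continuous_finsetSum _ fun j _ => h j)

variable [TopologicalSpace A]

/-- The letter at a position depends only on one tile and its starting point, both locally constant
in `s`. -/
theorem continuous_concat : Continuous (concat (θ := θ)) := by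
  refine continuous_pi fun m => continuous_iff_continuousAt.2 fun s => ?_
  obtain ⟨i, j, hj, rfl⟩ := exists_position s m
  refine (continuousAt_const (y := concat s (start s i + j))).congr ?_
  filter_upwards [(continuous_start i).continuousAt.eventually
    ((isOpen_discrete {start s i}).mem_nhds rfl),
    (continuous_apply i).continuousAt.eventually ((isOpen_discrete {s i}).mem_nhds rfl)]
    with s' h1 h2
  have h1 : start s' i = start s i := h1
  have h2 : s' i = s i := h2
  rw [concat_realises s i j hj, ← h1, concat_realises s' i j (by rw [h2]; exact hj)]
  exact getElem_congr h2.symm rfl _ _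

end Tile

/-! ### The suspension of the space of tilings -/

/-- All realisations of a letter have the same length. -/
def UniformLength : Prop := ∀ a, ∀ u ∈ θ.words a, ∀ v ∈ θ.words a, u.length = v.length

variable {θ} in
theorem UniformLength.len_eq (hθ : θ.UniformLength) {t t' : θ.Tile} (h : t.typ = t'.typ) :
    t.len = t'.len := hθ t.typ _ t.mem _ (h ▸ t'.mem)

/-- Sequences of tiles over `X_ϑ` with an origin in the tile at the index `0`. -/
abbrev Suspension : Type _ :=
  {e : (ℤ → θ.Tile) × ℕ // (fun i => (e.1 i).typ) ∈ θ.seqSet ∧ e.2 < (e.1 0).len}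

namespace Suspension

variable {θ}

/-- Finitely many tiles have bounded lengths, so the suspension is closed in a compact product.
Compactness later makes the continuous bijection onto `X_ϑ` a homeomorphism. -/
theorem compactSpace [Finite A] [TopologicalSpace A] [DiscreteTopology A] :
    CompactSpace θ.Suspension := by
  refine isCompact_iff_compactSpace.1 ?_
  obtain ⟨K, hK⟩ := (Set.finite_range (Tile.len (θ := θ))).bddAbove
  have ht : Continuous fun (e : (ℤ → θ.Tile) × ℕ) i => (e.1 i).typ := continuous_pi fun i =>
    (continuous_of_discreteTopology (f := Tile.typ (θ := θ))).comp
      ((continuous_apply i).comp continuous_fst)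
  have hX : IsClosed {e : (ℤ → θ.Tile) × ℕ | (fun i => (e.1 i).typ) ∈ θ.seqSet} :=
    θ.subshift.isClosed.preimage ht
  have hc : Continuous fun e : (ℤ → θ.Tile) × ℕ => (e.1 0, e.2) :=
    ((continuous_apply 0).comp continuous_fst).prodMk continuous_snd
  have hk : IsClosed {e : (ℤ → θ.Tile) × ℕ | e.2 < (e.1 0).len} :=
    (isClosed_discrete {p : θ.Tile × ℕ | p.2 < p.1.len}).preimage hc
  refine (isCompact_univ.prod (Set.finite_Iic K).isCompact).of_isClosed_subset (hX.inter hk) ?_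
  rintro e ⟨-, he⟩
  exact ⟨trivial, he.le.trans (hK ⟨_, rfl⟩)⟩

/-- The sequence of letters coded by a point of the suspension. -/
noncomputable def toSeq (e : θ.Suspension) : ℤ → A := shift (e.1.2 : ℤ) (Tile.concat e.1.1)

theorem shift_neg_toSeq (e : θ.Suspension) :
    shift (-(e.1.2 : ℤ)) (toSeq e) = Tile.concat e.1.1 := by
  rw [toSeq, ← shift_add, add_neg_cancel, shift_zero]

theorem continuous_toSeq [TopologicalSpace A] [DiscreteTopology A] :
    Continuous (toSeq (θ := θ)) := by
  refine continuous_pi fun m => ?_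
  refine continuous_eval_of_discrete (Y := θ.Suspension)
    (g := fun e n => Tile.concat e.1.1 n) (d := fun e => (e.1.2 : ℤ) + m) (fun n => ?_) ?_
  · exact (continuous_apply n).comp
      (Tile.continuous_concat.comp (continuous_fst.comp continuous_subtype_val))
  · exact (continuous_of_discreteTopology (f := fun k : ℕ => (k : ℤ) + m)).comp
      (continuous_snd.comp continuous_subtype_val)

section Recognisable

variable (hθ : θ.UniformLength) (hrec : θ.Recognisable)

include hθ hrec

/-- Recognisability yields only the letters and the offset. Uniform length then fixes all tile
boundaries, and the words of the tiles are read off from the sequence. -/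
theorem toSeq_injOn {e e' : θ.Suspension} (hx : toSeq e ∈ θ.seqSet) (h : toSeq e = toSeq e') :
    e = e' := by
  have key : ∀ e : θ.Suspension, (fun i => (e.1.1 i).typ) ∈ θ.seqSet ∧
      (∀ w ∈ θ.words (e.1.1 0).typ, e.1.2 < w.length) ∧
      shift (-(e.1.2 : ℤ)) (toSeq e) ∈ θ.onSeq (fun i => (e.1.1 i).typ) := fun e =>
    ⟨e.2.1, fun w hw => hθ _ _ (e.1.1 0).mem w hw ▸ e.2.2,
      (shift_neg_toSeq e).symm ▸ Tile.concat_mem_onSeq _⟩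
  obtain ⟨yk, -, huniq⟩ := hrec _ hx
  have h1 := (huniq (fun i => (e.1.1 i).typ, e.1.2) (key e)).trans
    (huniq (fun i => (e'.1.1 i).typ, e'.1.2) (by rw [h]; exact key e')).symm
  obtain ⟨⟨s, k⟩, he⟩ := e
  obtain ⟨⟨s', k'⟩, he'⟩ := e'
  simp only [Prod.mk.injEq] at h1
  obtain ⟨htyp, rfl⟩ := h1
  have hlen : ∀ i, (s i).len = (s' i).len := fun i => hθ.len_eq (congrFun htyp i)
  have hconc : Tile.concat s = Tile.concat s' := by
    have e1 := shift_neg_toSeq ⟨(s, k), he⟩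
    have e2 := shift_neg_toSeq ⟨(s', k), he'⟩
    rw [h] at e1
    exact e1.symm.trans e2
  have hstart : Tile.start s = Tile.start s' :=
    Tile.eq_start (Tile.start_zero s) fun i => by rw [Tile.start_succ, hlen]
  have hs : s = s' := by
    ext1 i
    refine Tile.ext (congrFun htyp i) (List.ext_getElem (hlen i) fun j hj hj' => ?_)
    rw [← Tile.concat_realises s i j hj, ← Tile.concat_realises s' i j hj', hconc, hstart]
  subst hs
  rfl

omit hθ in
theorem exists_toSeq_eq {x : ℤ → A} (hx : x ∈ θ.seqSet) : ∃ e : θ.Suspension, toSeq e = x := by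
  obtain ⟨⟨y, k⟩, ⟨hy, hk, h⟩, -⟩ := hrec x hx
  obtain ⟨s, hs, hc⟩ := Tile.exists_of_mem_onSeq h
  refine ⟨⟨(s, k), by rwa [show (fun i => (s i).typ) = y from funext hs], ?_⟩, ?_⟩
  · exact hk _ (hs 0 ▸ (s 0).mem)
  · simp only [toSeq, hc]
    rw [← shift_add, neg_add_cancel, shift_zero]

end Recognisable

variable [TopologicalSpace A] [DiscreteTopology A]

/-- Recognisability identifies the suspension with the subshift. -/
noncomputable def homeo [Finite A] (hθ : θ.UniformLength) (hrec : θ.Recognisable)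
    (hX : ∀ y ∈ θ.seqSet, θ.onSeq y ⊆ θ.seqSet) :
    θ.Suspension ≃ₜ θ.subshift.carrier :=
  haveI := compactSpace (θ := θ)
  have hmem : ∀ e : θ.Suspension, toSeq e ∈ θ.seqSet := fun e =>
    θ.subshift.mapsTo _ (hX _ e.2.1 (Tile.concat_mem_onSeq e.1.1))
  Continuous.homeoOfEquivCompactToT2
    (f := Equiv.ofBijective (fun e => ⟨toSeq e, hmem e⟩)
      ⟨fun _ _ h => toSeq_injOn hθ hrec (hmem _) (congrArg Subtype.val h), fun x =>
        (exists_toSeq_eq hrec x.2).imp fun _ h => Subtype.ext h⟩)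
    (continuous_toSeq.subtype_mk _)

/-- The shift map in terms of the suspension. -/
def next (e : θ.Suspension) : θ.Suspension :=
  if h : e.1.2 + 1 < (e.1.1 0).len then ⟨(e.1.1, e.1.2 + 1), e.2.1, h⟩
  else ⟨(shift 1 e.1.1, 0), θ.subshift.mapsTo 1 e.2.1, Tile.len_pos _⟩

theorem toSeq_next (e : θ.Suspension) : toSeq (next e) = shift 1 (toSeq e) := by
  unfold next
  split_ifs with h
  · simp only [toSeq, Nat.cast_add, Nat.cast_one, shift_add]
  · have h2 := e.2.2
    have h3 : (e.1.1 0).len = e.1.2 + 1 := by omega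
    simp only [toSeq, Nat.cast_zero, shift_zero, Tile.concat_shift, h3]
    rw [Nat.cast_add, Nat.cast_one, shift_add]

/-- The action on the suspension of a map of sequences of tiles that preserves the letters. -/
def lift (hθ : θ.UniformLength) (F : (ℤ → θ.Tile) → ℤ → θ.Tile)
    (hF : ∀ s i, (F s i).typ = (s i).typ) (e : θ.Suspension) : θ.Suspension :=
  ⟨(F e.1.1, e.1.2), by simpa only [hF] using e.2.1, by
    rw [hθ.len_eq (hF e.1.1 0)]; exact e.2.2⟩

/-- Lengths are preserved, so both sides take the same branch of `next`. -/
theorem lift_next (hθ : θ.UniformLength) {F : (ℤ → θ.Tile) → ℤ → θ.Tile}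
    (hF : ∀ s i, (F s i).typ = (s i).typ) (e : θ.Suspension)
    (h : F (shift 1 e.1.1) = shift 1 (F e.1.1)) :
    lift hθ F hF (next e) = next (lift hθ F hF e) := by
  have hl := hθ.len_eq (hF e.1.1 0)
  by_cases hk : e.1.2 + 1 < (e.1.1 0).len
  · have hk' : (lift hθ F hF e).1.2 + 1 < ((lift hθ F hF e).1.1 0).len := by
      simpa [lift, hl] using hk
    simp only [next, dif_pos hk, dif_pos hk']
    rfl
  · have hk' : ¬ (lift hθ F hF e).1.2 + 1 < ((lift hθ F hF e).1.1 0).len := by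
      simpa [lift, hl] using hk
    simp only [next, dif_neg hk, dif_neg hk']
    exact Subtype.ext (Prod.ext h rfl)

end Suspension

end RandomSubstitution

/-- A continuous action on a subshift that commutes with the shift map is a homomorphism to the
automorphism group. -/
theorem exists_hom_subshiftAut {A : Type*} [TopologicalSpace A] (X : Subshift A ℤ)
    {Γ : Type*} [Group Γ] (Ψ : Γ → X.carrier → X.carrier) (hcont : ∀ g, Continuous (Ψ g))
    (hone : ∀ x, Ψ 1 x = x) (hmul : ∀ g h x, Ψ (g * h) x = Ψ g (Ψ h x))
    (hshift : ∀ g x, Ψ g (subshiftHomeo X x) = subshiftHomeo X (Ψ g x)) :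
    ∃ φ : Γ →* subshiftAut X, ∀ g x, (φ g).1 x = Ψ g x := by
  let f : Γ →* (X.carrier ≃ₜ X.carrier) :=
    { toFun := fun g =>
        { toFun := Ψ g
          invFun := Ψ g⁻¹
          left_inv := fun x => by rw [← hmul, inv_mul_cancel, hone]
          right_inv := fun x => by rw [← hmul, mul_inv_cancel, hone]
          continuous_toFun := hcont g
          continuous_invFun := hcont g⁻¹ }
      map_one' := by ext1 x; exact hone x
      map_mul' := fun g h => by ext1 x; exact hmul g h x }
  refine ⟨f.codRestrict _ fun g => ?_, fun g x => rfl⟩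
  rw [subshiftAut, Subgroup.mem_centralizer_singleton_iff]
  ext1 x
  exact hshift g x

/-! ### Combinatorics of random substitutions -/

namespace RandomSubstitution

variable {A : Type*} {θ : RandomSubstitution A}

theorem append_mem_onWord {u u' v v' : List A} (h : v ∈ θ.onWord u) (h' : v' ∈ θ.onWord u') :
    v ++ v' ∈ θ.onWord (u ++ u') := by
  induction u generalizing v with
  | nil =>
    obtain rfl : v = [] := h
    simpa using h'
  | cons a u ih =>
    obtain ⟨w, hw, r, hr, rfl⟩ := h
    exact ⟨w, hw, r ++ v', ih hr, (List.append_assoc _ _ _).symm⟩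

theorem mem_onWord_singleton {a : A} {w : List A} (h : w ∈ θ.words a) : w ∈ θ.onWord [a] :=
  ⟨w, h, [], rfl, List.append_nil _⟩

theorem onWord_nonempty (u : List A) : (θ.onWord u).Nonempty := by
  induction u with
  | nil => exact ⟨[], rfl⟩
  | cons a u ih =>
    obtain ⟨w, hw⟩ := θ.nonempty a
    obtain ⟨r, hr⟩ := ih
    exact ⟨w ++ r, w, hw, r, hr, rfl⟩

theorem length_le_of_mem_onWord {u v : List A} (h : v ∈ θ.onWord u) : u.length ≤ v.length := by
  induction u generalizing v with
  | nil => simp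
  | cons a u ih =>
    obtain ⟨w, hw, r, hr, rfl⟩ := h
    have h1 := List.length_pos_iff.2 (fun e => θ.nil_notMem a (e ▸ hw) : w ≠ [])
    have h2 := ih hr
    simp only [List.length_append, List.length_cons]
    omega

theorem length_lt_of_mem_onWord {u v : List A} {a : A} (ha : ∀ w ∈ θ.words a, 2 ≤ w.length)
    (hau : a ∈ u) (h : v ∈ θ.onWord u) : u.length < v.length := by
  induction u generalizing v with
  | nil => simp at hau
  | cons b u ih =>
    obtain ⟨w, hw, r, hr, rfl⟩ := h
    simp only [List.length_append, List.length_cons]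
    rcases List.mem_cons.1 hau with rfl | hau
    · have h1 := ha w hw
      have h2 := length_le_of_mem_onWord hr
      omega
    · have h1 := List.length_pos_iff.2 (fun e => θ.nil_notMem b (e ▸ hw) : w ≠ [])
      have h2 := ih hau hr
      omega

theorem exists_mem_of_mem_onWord {u v : List A} {a : A} (h : v ∈ θ.onWord u) (ha : a ∈ v) :
    ∃ b ∈ u, ∃ w ∈ θ.words b, a ∈ w := by
  induction u generalizing v with
  | nil =>
    obtain rfl : v = [] := h
    simp at ha
  | cons b u ih =>
    obtain ⟨w, hw, r, hr, rfl⟩ := h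
    rcases List.mem_append.1 ha with ha | ha
    · exact ⟨b, by simp, w, hw, ha⟩
    · obtain ⟨b', hb', h⟩ := ih hr ha
      exact ⟨b', List.mem_cons_of_mem _ hb', h⟩

theorem mem_iter_succ {p : ℕ} {U : Set (List A)} {v : List A} :
    v ∈ θ.iter (p + 1) U ↔ ∃ u ∈ θ.iter p U, v ∈ θ.onWord u := by
  simp [iter, onSet]

theorem append_mem_iter {p : ℕ} {u u' v v' : List A} (h : v ∈ θ.iter p {u})
    (h' : v' ∈ θ.iter p {u'}) : v ++ v' ∈ θ.iter p {u ++ u'} := by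
  induction p generalizing v v' with
  | zero =>
    obtain rfl : v = u := h
    obtain rfl : v' = u' := h'
    rfl
  | succ p ih =>
    obtain ⟨w, hw, hv⟩ := mem_iter_succ.1 h
    obtain ⟨w', hw', hv'⟩ := mem_iter_succ.1 h'
    exact mem_iter_succ.2 ⟨w ++ w', ih hw hw', append_mem_onWord hv hv'⟩

theorem iter_nonempty (p : ℕ) (u : List A) : (θ.iter p {u}).Nonempty := by
  induction p with
  | zero => exact ⟨u, rfl⟩
  | succ p ih =>
    obtain ⟨v, hv⟩ := ih
    obtain ⟨w, hw⟩ := θ.onWord_nonempty v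
    exact ⟨w, mem_iter_succ.2 ⟨v, hv, hw⟩⟩

theorem length_le_of_mem_iter {p : ℕ} {u v : List A} (h : v ∈ θ.iter p {u}) :
    u.length ≤ v.length := by
  induction p generalizing v with
  | zero =>
    obtain rfl : v = u := h
    rfl
  | succ p ih =>
    obtain ⟨w, hw, hv⟩ := mem_iter_succ.1 h
    exact (ih hw).trans (length_le_of_mem_onWord hv)

theorem mem_iter_add {p q : ℕ} {U : Set (List A)} {u v : List A} (hu : u ∈ θ.iter q U)
    (hv : v ∈ θ.iter p {u}) : v ∈ θ.iter (q + p) U := by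
  induction p generalizing v with
  | zero =>
    obtain rfl : v = u := hv
    exact hu
  | succ p ih =>
    obtain ⟨w, hw, hv⟩ := mem_iter_succ.1 hv
    exact mem_iter_succ.2 ⟨w, ih hw, hv⟩

theorem Legal.of_infix {u v : List A} (h : θ.Legal v) (huv : u <:+: v) : θ.Legal u := by
  obtain ⟨a, p, w, hw, hv⟩ := h
  exact ⟨a, p, w, hw, huv.trans hv⟩

/-- Any realisations of the two flanks extend `v` to an inflation word of the next level. -/
theorem Legal.of_mem_onWord {u v : List A} (h : θ.Legal u) (hv : v ∈ θ.onWord u) :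
    θ.Legal v := by
  obtain ⟨a, p, w, hw, l, r, rfl⟩ := h
  obtain ⟨l', hl⟩ := θ.onWord_nonempty l
  obtain ⟨r', hr⟩ := θ.onWord_nonempty r
  exact ⟨a, p + 1, l' ++ v ++ r',
    mem_iter_succ.2 ⟨_, hw, append_mem_onWord (append_mem_onWord hl hv) hr⟩, l', r', rfl⟩

/-! ### Finite pieces of bi-infinite sequences -/

/-- The word of length `n` read at the position `i`. -/
def seg (x : ℤ → A) (i : ℤ) (n : ℕ) : List A := (List.range n).map fun k : ℕ => x (i + k)

theorem window_eq_seg (x : ℤ → A) (i : ℤ) (n : ℕ) : window x i n = seg x i (n + 1) := by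
  refine List.ext_getElem (by simp [window, seg]) fun k h1 h2 => by
    simp only [window, seg, List.getElem_ofFn, List.getElem_map, List.getElem_range]

theorem length_seg (x : ℤ → A) (i : ℤ) (n : ℕ) : (seg x i n).length = n := by simp [seg]

theorem seg_add (x : ℤ → A) (i : ℤ) (m n : ℕ) :
    seg x i (m + n) = seg x i m ++ seg x (i + m) n := by
  simp [seg, List.range_add, add_assoc, Function.comp_def]

theorem seg_infix (x : ℤ → A) {i j : ℤ} {m n : ℕ} (h1 : i ≤ j) (h2 : j + n ≤ i + m) :
    seg x j n <:+: seg x i m := by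
  obtain ⟨d, rfl⟩ := Int.le.dest h1
  obtain ⟨e, rfl⟩ : ∃ e, m = d + n + e := ⟨m - (d + n), by omega⟩
  rw [seg_add, seg_add]
  exact ⟨_, _, rfl⟩

theorem legal_seg {x : ℤ → A} (hx : x ∈ θ.seqSet) (i : ℤ) (n : ℕ) : θ.Legal (seg x i n) := by
  refine Legal.of_infix (window_eq_seg x i n ▸ hx i n) (seg_infix x le_rfl ?_)
  push_cast
  omega

theorem exists_seg_mem_onWord (s : ℤ → θ.Tile) (i : ℤ) (n : ℕ) :
    ∃ N : ℕ, Tile.start s (i + n) = Tile.start s i + N ∧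
      seg (Tile.concat s) (Tile.start s i) N ∈ θ.onWord (seg (fun i => (s i).typ) i n) := by
  induction n with
  | zero => exact ⟨0, by simp, rfl⟩
  | succ n ih =>
    obtain ⟨N, hN, h⟩ := ih
    refine ⟨N + (s (i + n)).len, ?_, ?_⟩
    · rw [Nat.cast_succ, ← add_assoc, Tile.start_succ, hN]
      push_cast
      ring
    · rw [seg_add, seg_add, ← hN]
      refine append_mem_onWord h ?_
      have e : seg (Tile.concat s) (Tile.start s (i + n)) (s (i + n)).len = (s (i + n)).word := by
        refine List.ext_getElem (length_seg _ _ _) fun k h1 h2 => ?_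
        simpa [seg] using Tile.concat_realises s (i + n) k h2
      rw [e]
      simpa [seg] using mem_onWord_singleton (s (i + n)).mem

/-- A window is covered by finitely many consecutive tiles, and their concatenation realises a legal
word of `y`. -/
theorem onSeq_subset_seqSet {y : ℤ → A} (hy : y ∈ θ.seqSet) : θ.onSeq y ⊆ θ.seqSet := by
  intro x hx i n
  obtain ⟨s, hs, rfl⟩ := Tile.exists_of_mem_onSeq hx
  obtain rfl : (fun i => (s i).typ) = y := funext hs
  obtain ⟨p, hp, -⟩ := (Tile.start_strictMono s).exists_le_lt i
  obtain ⟨q, hq, hq'⟩ := (Tile.start_strictMono s).exists_le_lt (i + n)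
  have hpq : p < q + 1 := (Tile.start_strictMono s).lt_iff_lt.1 (by omega)
  obtain ⟨m, hm⟩ := Int.le.dest hpq.le
  obtain ⟨N, hN, h⟩ := exists_seg_mem_onWord s p m
  rw [window_eq_seg]
  refine Legal.of_infix ((legal_seg hy p m).of_mem_onWord h) (seg_infix _ hp ?_)
  rw [hm] at hN
  push_cast
  omega

/-! ### Compatible and primitive random substitutions -/

theorem Compatible.perm [DecidableEq A] (hcomp : θ.Compatible) {a : A} {u v : List A}
    (hu : u ∈ θ.words a) (hv : v ∈ θ.words a) : u.Perm v :=
  List.perm_iff_count.2 fun b => congrFun (hcomp a u hu v hv) b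

theorem Compatible.uniformLength [DecidableEq A] (hcomp : θ.Compatible) : θ.UniformLength :=
  fun _ _ hu _ hv => (hcomp.perm hu hv).length_eq

theorem exists_ne_of_not_degenerate (h : ¬ θ.Degenerate) :
    ∃ a, ∃ u ∈ θ.words a, ∃ v ∈ θ.words a, u ≠ v := by
  simp only [Degenerate, not_forall] at h
  obtain ⟨a, ha⟩ := h
  have := Finset.card_pos.2 (θ.nonempty a)
  exact ⟨a, Finset.one_lt_card.1 (by omega)⟩

/-- A one-letter word is its only rearrangement, so two compatible distinct words are longer. -/
theorem Compatible.two_le_length [DecidableEq A] (hcomp : θ.Compatible) {a : A} {u v : List A}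
    (hu : u ∈ θ.words a) (hv : v ∈ θ.words a) (huv : u ≠ v) : ∀ w ∈ θ.words a, 2 ≤ w.length := by
  intro w hw
  rw [hcomp.uniformLength a w hw u hu]
  by_contra! h
  have hp := hcomp.perm hu hv
  match u, h with
  | [], _ => exact θ.nil_notMem a hu
  | [b], _ => exact huv (List.perm_singleton.1 hp.symm).symm

/-- If the set `Q` of letters is reached from every letter, then its occurrences in any sequence
of the subshift are unbounded in both directions. -/
theorem Recognisable.biUnbounded_of_level [DecidableEq A] (hcomp : θ.Compatible)
    (hrec : θ.Recognisable) (p : ℕ) (Q : Set A)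
    (h : ∀ b, ∃ v ∈ θ.level p b, ∃ a ∈ v, a ∈ Q) {x : ℤ → A} (hx : x ∈ θ.seqSet) :
    BiUnbounded {i | x i ∈ Q} := by
  induction p generalizing Q x with
  | zero =>
    have hQ : ∀ b, b ∈ Q := fun b => by
      obtain ⟨v, rfl, a, ha, haQ⟩ := h b
      rwa [List.mem_singleton.1 ha] at haQ
    exact fun N => ⟨⟨N + 1, hQ _, by omega⟩, N - 1, hQ _, by omega⟩
  | succ p ih =>
    obtain ⟨⟨y, k⟩, ⟨hy, -, hyx⟩, -⟩ := hrec x hx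
    obtain ⟨s, hs, hc⟩ := Tile.exists_of_mem_onSeq hyx
    replace hs : ∀ i, (s i).typ = y i := hs
    -- Induction applies to the preimage `y` and the letters having a realisation that meets `Q`.
    have hy' := ih {b | ∃ w ∈ θ.words b, ∃ a ∈ w, a ∈ Q} (fun b => by
      obtain ⟨v, hv, a, ha, haQ⟩ := h b
      obtain ⟨u, hu, hv⟩ := mem_iter_succ.1 hv
      obtain ⟨b', hb', w, hw, haw⟩ := exists_mem_of_mem_onWord hv ha
      exact ⟨u, hu, b', hb', w, hw, a, haw, haQ⟩) hy
    have key : ∀ i, (∃ w ∈ θ.words (y i), ∃ a ∈ w, a ∈ Q) →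
        ∃ m, Tile.start s i ≤ m ∧ m < Tile.start s (i + 1) ∧ x (m - k) ∈ Q := by
      rintro i ⟨w, hw, a, ha, haQ⟩
      have ha' : a ∈ (s i).word := (hcomp.perm (hs i ▸ (s i).mem) hw).mem_iff.2 ha
      obtain ⟨j, hj, rfl⟩ := List.getElem_of_mem ha'
      refine ⟨Tile.start s i + j, by omega, ?_, ?_⟩
      · rw [Tile.start_succ, Tile.len]
        omega
      · rw [← Tile.concat_realises s i j hj, hc, shift_apply] at haQ
        rwa [sub_eq_neg_add]
    have hmono := Tile.start_strictMono s
    have h0 := Tile.start_zero s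
    intro N
    constructor
    · obtain ⟨i, hi, hNi⟩ := (hy' (max 0 (N + k))).1
      obtain ⟨m, h1, -, hm⟩ := key i hi
      have := hmono.add_sub_le (i := 0) (j := i) (by omega)
      exact ⟨m - k, hm, by omega⟩
    · obtain ⟨i, hi, hNi⟩ := (hy' (min 0 (N + k))).2
      obtain ⟨m, -, h2, hm⟩ := key i hi
      have := hmono.add_sub_le (i := i + 1) (j := 0) (by omega)
      exact ⟨m - k, hm, by omega⟩

/-- Within `p` further levels `a` reappears, and the next substitution then strictly lengthens the
word. -/
theorem Primitive.exists_long_legal (hprim : θ.Primitive) {a : A}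
    (ha : ∀ w ∈ θ.words a, 2 ≤ w.length) (n : ℕ) : ∃ u, θ.Legal u ∧ n ≤ u.length := by
  obtain ⟨p, -, hp⟩ := hprim
  suffices h : ∃ q, ∃ u ∈ θ.level q a, n < u.length by
    obtain ⟨q, u, hu, hn⟩ := h
    exact ⟨u, ⟨a, q, u, hu, List.infix_refl _⟩, hn.le⟩
  induction n with
  | zero => exact ⟨0, [a], rfl, by simp⟩
  | succ n ih =>
    obtain ⟨q, u, hu, hn⟩ := ih
    obtain ⟨b, r, rfl⟩ := List.exists_cons_of_length_pos (by omega : 0 < u.length)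
    obtain ⟨v, hv, hav⟩ := hp a b
    obtain ⟨v', hv'⟩ := θ.iter_nonempty p r
    have hvv : v ++ v' ∈ θ.iter p {b :: r} := append_mem_iter (u := [b]) hv hv'
    obtain ⟨w, hw⟩ := θ.onWord_nonempty (v ++ v')
    refine ⟨q + p + 1, w, mem_iter_succ.2 ⟨_, mem_iter_add hu hvv, hw⟩, ?_⟩
    have h1 := length_le_of_mem_iter hvv
    have h2 := length_lt_of_mem_onWord ha
      (List.mem_append_left _ (hav.subset (List.mem_singleton_self a))) hw
    omega

/-- Compactness: the conditions that the central block of radius `n` is legal are closed, nested and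
satisfiable. -/
theorem seqSet_nonempty_of_long_legal [Finite A] [TopologicalSpace A] [DiscreteTopology A]
    (h : ∀ n : ℕ, ∃ u, θ.Legal u ∧ n ≤ u.length) : θ.seqSet.Nonempty := by
  let C : ℕ → Set (ℤ → A) := fun n => {x | θ.Legal (seg x (-n) (2 * n + 1))}
  have hclosed : ∀ n, IsClosed (C n) := fun n => by
    have hc : Continuous fun (x : ℤ → A) (k : Fin (2 * n + 1)) => x (-n + k) := by fun_prop
    have := (isClosed_discrete {w : Fin (2 * n + 1) → A | θ.Legal (List.ofFn w)}).preimage hc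
    convert this using 1
    ext x
    simp only [C, ← window_eq_seg]
    rfl
  have hne : ∀ n, (C n).Nonempty := fun n => by
    obtain ⟨u, hu, hn⟩ := h (2 * n + 1)
    have h0 : 0 < u.length := by omega
    -- Only the block from `-n` to `n` matters; the values outside `u` are arbitrary.
    refine ⟨fun i => u.getD (i + n).toNat (u[0]), hu.of_infix (List.IsPrefix.isInfix ?_)⟩
    rw [List.prefix_iff_eq_take]
    refine List.ext_getElem (by simp [length_seg, hn]) fun k h1 h2 => ?_
    rw [length_seg] at h1
    have hk : k < u.length := by omega
    simp [seg, hk]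
  obtain ⟨x, hx⟩ := IsCompact.nonempty_iInter_of_sequence_nonempty_isCompact_isClosed C
    (fun n x hx => Legal.of_infix hx (seg_infix x (by push_cast; omega) (by push_cast; omega)))
    hne (hclosed 0).isCompact hclosed
  refine ⟨x, fun i n => ?_⟩
  rw [window_eq_seg]
  exact Legal.of_infix (Set.mem_iInter.1 hx (i.natAbs + n + 1))
    (seg_infix x (by omega) (by omega))

end RandomSubstitution

/-! ### Embedding the automorphism group of the full shift -/

/-- The action of the automorphism group of a full shift. -/
def ShiftAction.ofAut (S : Type*) [TopologicalSpace S] :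
    ShiftAction (subshiftAut (fullShift S ℤ)) S where
  act f u := (f.1 ⟨u, trivial⟩).1
  continuous_act f := continuous_subtype_val.comp
    (f.1.continuous.comp (continuous_id.subtype_mk fun _ => trivial))
  one_act _ := rfl
  mul_act _ _ _ := rfl
  act_shift_one f u :=
    have h := Subgroup.mem_centralizer_singleton_iff.1 f.2
    congrArg Subtype.val (DFunLike.congr_fun h ⟨u, trivial⟩)

theorem ShiftAction.exists_ofAut_ne {S : Type*} [TopologicalSpace S]
    {f : subshiftAut (fullShift S ℤ)} (hf : f ≠ 1) :
    ∃ u, (ShiftAction.ofAut S).act f u ≠ u := by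
  by_contra! h
  exact hf (Subtype.ext (Homeomorph.ext fun u => Subtype.ext (h u.1)))

namespace RandomSubstitution

variable {A : Type*} [Finite A] [TopologicalSpace A] [DiscreteTopology A]
  {θ : RandomSubstitution A}

/-- An action on sequences of tiles that changes the realisations of a recurrent letter only,
induces an action on the subshift. -/
theorem exists_hom_of_action {Γ : Type*} [Group Γ] (α : ShiftAction Γ θ.Tile)
    (hα : ∀ g u i, (α.act g u i).typ = (u i).typ) (hθ : θ.UniformLength) (hrec : θ.Recognisable)
    {a : A} (ha : ∀ x ∈ θ.seqSet, BiUnbounded {i | x i = a}) (hne : θ.seqSet.Nonempty)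
    (hfaith : ∀ g ≠ 1, ∃ u : ℤ → θ.Tile, (∀ i, (u i).typ = a) ∧ α.act g u ≠ u) :
    ∃ φ : Γ →* subshiftAut θ.subshift, Function.Injective φ := by
  let F : Γ → (ℤ → θ.Tile) → ℤ → θ.Tile := InducedAction.fn Tile.typ a α
  have hF : ∀ g s i, (F g s i).typ = (s i).typ := fun g s i => InducedAction.kind_fn α hα g s i
  have hs : ∀ e : θ.Suspension, BiUnbounded (InducedAction.occ Tile.typ a e.1.1) :=
    fun e => ha _ e.2.1
  let π := Suspension.homeo hθ hrec fun y hy => onSeq_subset_seqSet hy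
  let G : Γ → θ.Suspension → θ.Suspension := fun g => Suspension.lift hθ (F g) (hF g)
  have hG : ∀ g, Continuous (G g) := by
    intro g
    have h1 : Continuous fun e : θ.Suspension =>
        (⟨e.1.1, hs e⟩ : {s : ℤ → θ.Tile // BiUnbounded (InducedAction.occ Tile.typ a s)}) :=
      (continuous_fst.comp continuous_subtype_val).subtype_mk _
    exact (((InducedAction.continuous_fn α g).comp h1).prodMk
      (continuous_snd.comp continuous_subtype_val)).subtype_mk _
  have hnext : ∀ e, π (Suspension.next e) = subshiftHomeo θ.subshift (π e) := fun e =>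
    Subtype.ext (Suspension.toSeq_next e)
  obtain ⟨φ, hφ⟩ := exists_hom_subshiftAut θ.subshift (fun g x => π (G g (π.symm x)))
    (fun g => π.continuous.comp ((hG g).comp π.symm.continuous))
    (fun x => by
      have : G 1 (π.symm x) = π.symm x :=
        Subtype.ext (Prod.ext (InducedAction.fn_one α _) rfl)
      simp only [this, Homeomorph.apply_symm_apply])
    (fun g h x => by
      have : G (g * h) (π.symm x) = G g (G h (π.symm x)) :=
        Subtype.ext (Prod.ext (InducedAction.fn_mul α hα (hs _) g h) rfl)
      simp only [this, Homeomorph.symm_apply_apply])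
    (fun g x => by
      obtain ⟨e, rfl⟩ := π.surjective x
      have : G g (Suspension.next e) = Suspension.next (G g e) :=
        Suspension.lift_next hθ (hF g) e (InducedAction.fn_shift α (hs e) g)
      change π (G g (π.symm (subshiftHomeo _ (π e)))) =
        subshiftHomeo _ (π (G g (π.symm (π e))))
      rw [← hnext, π.symm_apply_apply, this, hnext, π.symm_apply_apply])
  refine ⟨φ, (injective_iff_map_eq_one φ).2 fun g hg => ?_⟩
  by_contra hg1
  obtain ⟨u, hu, hgu⟩ := hfaith g hg1
  obtain ⟨x, hx⟩ := hne
  obtain ⟨s, hsu, hgs⟩ :=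
    InducedAction.exists_fn_ne α (hs (π.symm ⟨x, hx⟩)) hu hgu
  have hmem : (fun i => (s i).typ) ∈ θ.seqSet := by
    rw [funext hsu]
    exact (π.symm ⟨x, hx⟩).2.1
  -- Altering tiles within their letters stays over the same point of `X_ϑ`, so `s` with offset `0`
  -- is a point of the suspension that `G g` moves.
  let e : θ.Suspension := ⟨(s, 0), hmem, Tile.len_pos _⟩
  have h : (φ g).1 (π e) = π (G g (π.symm (π e))) := hφ g (π e)
  rw [hg, π.symm_apply_apply] at h
  have h' : π e = π (G g e) := h
  exact hgs (congrArg (fun e : θ.Suspension => e.1.1) (π.injective h')).symm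

end RandomSubstitution

theorem theorem4 {A : Type*} [Finite A] [DecidableEq A] [TopologicalSpace A] [DiscreteTopology A]
    (θ : RandomSubstitution A) (hnd : ¬ θ.Degenerate) (hcomp : θ.Compatible)
    (hprim : θ.Primitive) (hrec : θ.Recognisable) :
    ∃ φ : subshiftAut (fullShift (Fin 2) ℤ) →* subshiftAut θ.subshift,
      Function.Injective φ := by
  obtain ⟨a, u, hu, v, hv, huv⟩ := RandomSubstitution.exists_ne_of_not_degenerate hnd
  let z : θ.Tile := ⟨a, u, hu⟩
  let o : θ.Tile := ⟨a, v, hv⟩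
  have hzo : z ≠ o := fun h => huv (congrArg RandomSubstitution.Tile.word h)
  refine RandomSubstitution.exists_hom_of_action (a := a)
    (ConveyorBelt.action z o (ShiftAction.ofAut (Fin 2)) hzo)
    (fun g s i => ?_) hcomp.uniformLength hrec (fun x hx => ?_) ?_ (fun g hg => ?_)
  -- A tile is changed only from one of `z`, `o` to one of `z`, `o`, and both have letter `a`.
  · rcases ConveyorBelt.beltFun_eq_or z o (ShiftAction.ofAut (Fin 2)) hzo g s i with h | ⟨h, h'⟩
    · exact congrArg RandomSubstitution.Tile.typ h
    · have key : ∀ t : θ.Tile, t = z ∨ t = o → t.typ = a := by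
        rintro t (rfl | rfl) <;> rfl
      exact (key _ h').trans (key _ h).symm
  · obtain ⟨p, -, hp⟩ := hprim
    refine hrec.biUnbounded_of_level hcomp p {a} (fun b => ?_) hx
    obtain ⟨w, hw, haw⟩ := hp a b
    exact ⟨w, hw, a, haw.subset (List.mem_singleton_self a), rfl⟩
  · exact RandomSubstitution.seqSet_nonempty_of_long_legal
      (hprim.exists_long_legal (hcomp.two_le_length hu hv huv))
  · obtain ⟨c, hc⟩ := ShiftAction.exists_ofAut_ne hg
    obtain ⟨s, hs, hgs⟩ :=
      ConveyorBelt.exists_beltFun_ne z o (ShiftAction.ofAut (Fin 2)) hzo hc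
    exact ⟨s, fun i => by rcases hs i with h | h <;> rw [h], hgs⟩
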